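/- For $t\in\{1,2,3\}$ let $(\Omega_t,\mathcal A_t,\mu_t)$ be a probability space, $T_t$ an invertible (bimeasurable) measure preserving ergodic transformation of it, and $\mathcal F^{(t)}_0\subset\mathcal A_t$ a sub-$\sigma$-algebra with $T_t\mathcal F^{(t)}_0\subset\mathcal F^{(t)}_0$. On $\Omega=\Omega_1\times\Omega_2\times\Omega_3$ with $\mathcal A=\mathcal A_1\otimes\mathcal A_2\otimes\mathcal A_3$ and $\mu=\mu_1\otimes\mu_2\otimes\mu_3$, consider the $\mathbb Z^3$-action and the filtration $$T_{i,j,k}(\omega_1,\omega_2,\omega_3)=(T_1^i\omega_1,T_2^j\omega_2,T_3^k\omega_3),\qquad \mathcal F_{i,j,k}=(T_1^{-i}\mathcal F^{(1)}_0)\otimes(T_2^{-j}\mathcal F^{(2)}_0)\otimes(T_3^{-k}\mathcal F^{(3)}_0),$$ where $i,j,k\in\mathbb Z$. Let $\mathcal F_{-1,\infty,\infty}=\bigvee_{j,k\in\mathbb Z}\mathcal F_{-1,j,k}$, and define $\mathcal F_{\infty,-1,\infty}$ and $\mathcal F_{\infty,\infty,-1}$ similarly. A martingale difference is a real-valued $\mathcal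 F_{0,0,0}$-measurable function $f\in L^2(\mu)$ with $$\mathbb E[f\mid\mathcal F_{-1,\infty,\infty}]=\mathbb E[f\mid\mathcal F_{\infty,-1,\infty}]=\mathbb E[f\mid\mathcal F_{\infty,\infty,-1}]=0\quad\text{a.s.}$$ (1) For every such system and every martingale difference $f$ there is a family of real numbers $(\lambda_{a,b,c}(f))_{a,b,c\ge1}$ with $\sum_{a,b,c\ge1}\lambda_{a,b,c}(f)^2<\infty$ such that, whenever $(N^{(1)}_a)_{a\ge1}$, $(N^{(2)}_b)_{b\ge1}$, $(N^{(3)}_c)_{c\ge1}$ are three mutually independent i.i.d. sequences of standard normal random variables on a probability space, $$\frac1{\sqrt{\ell mn}}\sum_{i=1}^{\ell}\sum_{j=1}^{m}\sum_{k=1}^{n}f\circ T_{i,j,k}\longrightarrow\sum_{a,b,c=1}^{\infty}\lambda_{a,b,c}(f)\,N^{(1)}_aN^{(2)}_bN^{(3)}_c$$ in distribution as $\min\{\ell,m,n\}\to\infty$, where the series on the right converges unconditionally in $L^2$. (2) Conversely, for every square-summable family $(\lambda_{a,b,c})_{a,b,c\ge1}$ of real numbers there are a system as above and a martingale difference $f$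 on it for which the convergence in (1) holds with $\lambda_{a,b,c}(f)=\lambda_{a,b,c}$. -/

import Mathlib

open MeasureTheory ProbabilityTheory Filter Topology
open scoped ENNReal

noncomputable section

namespace FieldCLT

/-- One coordinate of the product system: a probability measure `μ`, an invertible bimeasurable
map `T` that preserves `μ` and is ergodic, and a sub-σ-algebra `F₀` with `T F₀ ⊆ F₀`. -/
structure FilteredSystem (Ω : Type*) [mΩ : MeasurableSpace Ω] where
  μ : Measure Ω
  isProbabilityMeasure : IsProbabilityMeasure μ
  T : Ω ≃ᵐ Ω
  ergodic : Ergodic T μ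
  F₀ : MeasurableSpace Ω
  F₀_le : F₀ ≤ mΩ
  image_mem : ∀ A : Set Ω, MeasurableSet[F₀] A → MeasurableSet[F₀] (T '' A)

attribute [instance] FilteredSystem.isProbabilityMeasure

/-- The iterate `T ^ i`, for `i ∈ ℤ`. -/
def FilteredSystem.iter {Ω : Type*} [MeasurableSpace Ω] (S : FilteredSystem Ω) (i : ℤ) :
    Ω → Ω :=
  ((S.T.toEquiv : Equiv.Perm Ω) ^ i : Equiv.Perm Ω)

/-- The σ-algebra `T⁻ⁱ F₀ = {(T ^ i)⁻¹(A) : A ∈ F₀}`. -/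
abbrev FilteredSystem.filt {Ω : Type*} [MeasurableSpace Ω] (S : FilteredSystem Ω) (i : ℤ) :
    MeasurableSpace Ω :=
  MeasurableSpace.comap (S.iter i) S.F₀

section Product

variable {Ω₁ Ω₂ Ω₃ : Type*} [MeasurableSpace Ω₁] [MeasurableSpace Ω₂] [MeasurableSpace Ω₃]

/-- The product measure `μ₁ ⊗ μ₂ ⊗ μ₃`. -/
def prodMeasure (S₁ : FilteredSystem Ω₁) (S₂ : FilteredSystem Ω₂) (S₃ : FilteredSystem Ω₃) :
    Measure (Ω₁ × Ω₂ × Ω₃) :=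
  S₁.μ.prod (S₂.μ.prod S₃.μ)

instance (S₁ : FilteredSystem Ω₁) (S₂ : FilteredSystem Ω₂) (S₃ : FilteredSystem Ω₃) :
    IsProbabilityMeasure (prodMeasure S₁ S₂ S₃) := by
  unfold prodMeasure; infer_instance

/-- The product action `T_{i,j,k} (ω₁, ω₂, ω₃) = (T₁ ^ i ω₁, T₂ ^ j ω₂, T₃ ^ k ω₃)`. -/
def prodAction (S₁ : FilteredSystem Ω₁) (S₂ : FilteredSystem Ω₂) (S₃ : FilteredSystem Ω₃)
    (i j k : ℤ) (ω : Ω₁ × Ω₂ × Ω₃) : Ω₁ × Ω₂ × Ω₃ :=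
  (S₁.iter i ω.1, S₂.iter j ω.2.1, S₃.iter k ω.2.2)

/-- The product filtration `F_{i,j,k} = (T₁⁻ⁱ F₀⁽¹⁾) ⊗ (T₂⁻ʲ F₀⁽²⁾) ⊗ (T₃⁻ᵏ F₀⁽³⁾)`. -/
abbrev prodFilt (S₁ : FilteredSystem Ω₁) (S₂ : FilteredSystem Ω₂) (S₃ : FilteredSystem Ω₃)
    (i j k : ℤ) : MeasurableSpace (Ω₁ × Ω₂ × Ω₃) :=
  (S₁.filt i).prod ((S₂.filt j).prod (S₃.filt k))

end Product

/-- `f` is a (square integrable) martingale difference adapted to `(F_{i,j,k})`. The σ-algebra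
`F_{-1,∞,∞}` is generated by the `F_{-1,j,k}`, `j, k ∈ ℤ`, and so on. -/
structure IsMartingaleDifference {Ω : Type*} [MeasurableSpace Ω]
    (F : ℤ → ℤ → ℤ → MeasurableSpace Ω) (μ : Measure Ω) (f : Ω → ℝ) : Prop where
  measurable : Measurable[F 0 0 0] f
  memLp : MemLp f 2 μ
  condExp₁ : μ[f | ⨆ (j : ℤ) (k : ℤ), F (-1) j k] =ᵐ[μ] 0
  condExp₂ : μ[f | ⨆ (i : ℤ) (k : ℤ), F i (-1) k] =ᵐ[μ] 0
  condExp₃ : μ[f | ⨆ (i : ℤ) (j : ℤ), F i j (-1)] =ᵐ[μ] 0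

/-- The normalized rectangular sum
`(ℓ m n)^{-1/2} ∑_{i=1}^ℓ ∑_{j=1}^m ∑_{k=1}^n f ∘ T_{i,j,k}`, where `p = (ℓ, m, n)`. -/
def normalizedSum {Ω : Type*} (T : ℤ → ℤ → ℤ → Ω → Ω) (f : Ω → ℝ) (p : ℕ × ℕ × ℕ) (ω : Ω) : ℝ :=
  (1 / Real.sqrt ((p.1 : ℝ) * p.2.1 * p.2.2)) *
    ∑ i ∈ Finset.Icc 1 p.1, ∑ j ∈ Finset.Icc 1 p.2.1, ∑ k ∈ Finset.Icc 1 p.2.2,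
      f (T (i : ℤ) (j : ℤ) (k : ℤ) ω)

/-- The filter of statements that hold as `min {ℓ, m, n} → ∞`. -/
def minAtTop : Filter (ℕ × ℕ × ℕ) :=
  comap (fun p => min p.1 (min p.2.1 p.2.2)) atTop

/-- `N 0`, `N 1`, `N 2` are three mutually independent sequences, each of them i.i.d. with standard
normal law. -/
structure IsIndepGaussianSequences {Ω : Type*} [MeasurableSpace Ω] (P : Measure Ω)
    (N : Fin 3 → ℕ → Ω → ℝ) : Prop where
  measurable : ∀ t a, Measurable (N t a)
  hasLaw : ∀ t a, HasLaw (N t a) (gaussianReal 0 1) P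
  iIndepFun_each : ∀ t, iIndepFun (N t) P
  iIndepFun_seq : iIndepFun (fun (t : Fin 3) (ω : Ω) (a : ℕ) => N t a ω) P

/-- `S` is the sum of the series `∑_{a,b,c} lam (a,b,c) N⁽¹⁾_a N⁽²⁾_b N⁽³⁾_c`, which converges
unconditionally in `L²(P)`. -/
structure IsTripleGaussianSum {Ω : Type*} [MeasurableSpace Ω] (P : Measure Ω)
    (N : Fin 3 → ℕ → Ω → ℝ) (lam : ℕ × ℕ × ℕ → ℝ) (S : Ω → ℝ) : Prop where
  memLp : MemLp S 2 P
  tendsto : Tendsto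
    (fun s : Finset (ℕ × ℕ × ℕ) =>
      eLpNorm (fun ω => (∑ p ∈ s, lam p * (N 0 p.1 ω * N 1 p.2.1 ω * N 2 p.2.2 ω)) - S ω) 2 P)
    atTop (𝓝 0)

end FieldCLT

end

/-!
The proof takes place in `L²`, where the product space is a Hilbert tensor product and the tensor
`x ⊗ y ⊗ z` is the function `x ω₁ * y ω₂ * z ω₃` (`tens`). The normalized rectangular sum factors on
tensors: it sends `x ⊗ y ⊗ z` to `A_ℓ x ⊗ A_m y ⊗ A_n z`, where `A_n` is the normalized sum of one
system (`prodNormSum_tens`). If `x`, `y` and `z` are martingale differences of their systems, then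
`A_ℓ x`, `A_m y` and `A_n z` are independent and asymptotically Gaussian, so that their product
converges to a product of independent Gaussian variables. The theorem extends this to series.

**Structure of martingale differences.** Every martingale difference `f` on the product lies in the
closed span of the tensors of one-dimensional martingale differences (`mem_closure_span_diffTens`).
After the choice of orthogonal systems of such differences, `f = ∑ λ_{abc} e_a ⊗ e_b ⊗ e_c` in `L²`
(`exists_hasSum_tens`).

**Limit theorem for one system.** For an ergodic martingale difference `X` the characteristic
functions of the partial sums satisfy `φ_{k+1}(u) ≈ (1 - u² E X² / 2) φ_k(u)`: the first order term
vanishes by the martingale property, and `X²` may be replaced by its mean because `X² - E X²` is an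
`L¹` limit of coboundaries `g - g ∘ T`, which almost cancel against the slowly varying exponential
of the partial sum (`tendsto_integral_exp_birkhoffSum`). Applied to linear
combinations, this gives joint convergence of finitely many orthogonal differences
(`FilteredSystem.tendstoInDistribution_normSum`).

**Passage to series.** The operators `A_n` are isometric on martingale differences, so that the
remainders of `∑ λ_{abc} A_ℓ e_a ⊗ A_m e_b ⊗ A_n e_c` are small in `L²` uniformly in `ℓ`, `m`, `n`,
as are those of the limiting Gaussian series (`exists_tripleGaussianSum_of_hasSum`).

**Realization.** All three systems are the shift on `ℤ × ℕ` independent standard normal variables,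
and `e_a` is the coordinate with index `(0, a)`. The shift is ergodic because cylinders are
independent of their distant translates (`ergodic_shift`), and every convergent series of tensors
of martingale differences is again a martingale difference
(`exists_isMartingaleDifference_of_hasSum`).
-/

namespace FieldCLT

/-! ### Central limit theorem for stationary ergodic sequences -/

section CLT

variable {Ω : Type*} [MeasurableSpace Ω] {μ : Measure Ω} {R : Ω → Ω}

lemma integral_comp_of_measurePreserving {E : Type*} [NormedAddCommGroup E] [NormedSpace ℝ E]
    {Ω' : Type*} [MeasurableSpace Ω'] {ν : Measure Ω'} {R : Ω → Ω'} (hR : MeasurePreserving R μ ν)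
    {g : Ω' → E} (hg : AEStronglyMeasurable g ν) : ∫ ω, g (R ω) ∂μ = ∫ ω, g ω ∂ν := by
  rw [← hR.map_eq] at hg ⊢
  exact (integral_map hR.measurable.aemeasurable hg).symm

lemma coeFn_sum_Lp {ι : Type*} (s : Finset ι) (f : ι → Lp ℝ 2 μ) :
    (∑ i ∈ s, f i : Lp ℝ 2 μ) =ᵐ[μ] fun ω => ∑ i ∈ s, f i ω := by
  classical
  induction s using Finset.induction_on with
  | empty => simp only [Finset.sum_empty]; exact Lp.coeFn_zero ℝ 2 μ
  | insert a s ha ih =>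
    rw [Finset.sum_insert ha]
    filter_upwards [Lp.coeFn_add (f a) (∑ i ∈ s, f i), ih] with ω h1 h2
    rw [h1, Pi.add_apply, h2, Finset.sum_insert ha]

lemma inner_const_Lp (h y : Lp ℝ 2 μ) {c : ℝ} (hc : h =ᵐ[μ] fun _ => c) :
    inner ℝ h y = c * ∫ ω, y ω ∂μ := by
  rw [L2.inner_def, ← integral_const_mul]
  refine integral_congr_ae ?_
  filter_upwards [hc] with ω hω
  simp [hω, mul_comm]

/-- In `L²`, the coboundaries of an ergodic map are dense among the centred functions: a vector
`h` orthogonal to all of them satisfies `⟪h, h⟫ = ⟪h, h ∘ R⟫`, hence is invariant, hence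
constant. -/
lemma exists_norm_sub_coboundary_lt (hR : Ergodic R μ) (y : Lp ℝ 2 μ) (hy : ∫ ω, y ω ∂μ = 0)
    {ε : ℝ} (hε : 0 < ε) :
    ∃ g : Lp ℝ 2 μ,
      ‖y - (g - Lp.compMeasurePreservingₗᵢ ℝ R hR.toMeasurePreserving g)‖ < ε := by
  set U := Lp.compMeasurePreservingₗᵢ (E := ℝ) (p := 2) ℝ R hR.toMeasurePreserving with hU
  set D : Submodule ℝ (Lp ℝ 2 μ) := LinearMap.range (LinearMap.id - U.toLinearMap) with hD
  have hmem : y ∈ D.topologicalClosure := by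
    rw [← Submodule.orthogonal_orthogonal_eq_closure, Submodule.mem_orthogonal]
    intro h hh
    have h1 : inner ℝ (h - U h) h = 0 := (Submodule.mem_orthogonal _ _).1 hh _ ⟨h, rfl⟩
    have h2 : U h = h := by
      have : ‖h - U h‖ ^ 2 = 0 := by
        rw [inner_sub_left, real_inner_self_eq_norm_sq, real_inner_comm] at h1
        rw [norm_sub_sq_real, U.norm_map]
        linarith
      have := pow_eq_zero_iff (two_ne_zero) |>.1 this
      exact (sub_eq_zero.1 (norm_eq_zero.1 this)).symm
    obtain ⟨c, hc⟩ := hR.ae_eq_const_of_ae_eq_comp_ae (Lp.aestronglyMeasurable h) (by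
      have := Lp.coeFn_compMeasurePreserving h hR.toMeasurePreserving
      have h3 : Lp.compMeasurePreserving R hR.toMeasurePreserving h = h := h2
      rw [h3] at this
      exact this.symm)
    rw [inner_const_Lp h y hc, hy, mul_zero]
  obtain ⟨z, ⟨g, rfl⟩, hz⟩ := Metric.mem_closure_iff.1 hmem ε hε
  exact ⟨g, by simpa [dist_eq_norm] using hz⟩

lemma integral_abs_le_norm_Lp [IsProbabilityMeasure μ] (y : Lp ℝ 2 μ) : ∫ ω, |y ω| ∂μ ≤ ‖y‖ := by
  have h1 : eLpNorm y 1 μ ≤ eLpNorm y 2 μ :=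
    eLpNorm_le_eLpNorm_of_exponent_le (by norm_num) (Lp.aestronglyMeasurable y)
  have h2 : ∫ ω, |y ω| ∂μ = (eLpNorm y 1 μ).toReal := by
    rw [eLpNorm_one_eq_lintegral_enorm, ← integral_norm_eq_lintegral_enorm
      (Lp.aestronglyMeasurable y)]
    simp
  rw [h2, Lp.norm_def]
  exact ENNReal.toReal_mono (Lp.eLpNorm_ne_top y) h1

/-- In `L¹`, a centred function is approximated by coboundaries `g - g ∘ R` with `g ∈ L²`. -/
lemma exists_coboundary_approx [IsProbabilityMeasure μ] (hR : Ergodic R μ) {Y : Ω → ℝ}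
    (hY : Integrable Y μ) (hY0 : ∫ ω, Y ω ∂μ = 0) {ε : ℝ} (hε : 0 < ε) :
    ∃ g : Ω → ℝ, MemLp g 2 μ ∧ ∫ ω, |Y ω - (g ω - g (R ω))| ∂μ < ε := by
  obtain ⟨s, hs, hsm⟩ := (memLp_one_iff_integrable.2 hY).exists_simpleFunc_eLpNorm_sub_lt
    ENNReal.one_ne_top (ε := ENNReal.ofReal (ε / 4)) (by simpa using by positivity)
  have hs2 : MemLp s 2 μ := s.memLp_of_isFiniteMeasure 2 μ
  have hsi : Integrable s μ := hs2.integrable (by norm_num)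
  have hYs : ∫ ω, |Y ω - s ω| ∂μ < ε / 4 := by
    have : ∫ ω, |Y ω - s ω| ∂μ = (eLpNorm (Y - ⇑s) 1 μ).toReal := by
      rw [eLpNorm_one_eq_lintegral_enorm, ← integral_norm_eq_lintegral_enorm
        (hY.sub hsi).aestronglyMeasurable]
      simp
    rw [this]
    exact (ENNReal.lt_ofReal_iff_toReal_lt (ne_top_of_lt hs)).1 hs
  set c := ∫ ω, s ω ∂μ with hc
  have hcle : |c| ≤ ε / 4 := by
    have : c = - ∫ ω, (Y ω - s ω) ∂μ := by rw [integral_sub hY hsi, hY0]; simp [hc]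
    rw [this, abs_neg]
    exact (abs_integral_le_integral_abs).trans hYs.le
  have hy2 : MemLp (fun ω => s ω - c) 2 μ := hs2.sub (memLp_const c)
  set y : Lp ℝ 2 μ := hy2.toLp with hy
  have hyae : y =ᵐ[μ] fun ω => s ω - c := hy2.coeFn_toLp
  obtain ⟨g, hg⟩ := exists_norm_sub_coboundary_lt hR y
    (by rw [integral_congr_ae hyae, integral_sub hsi (integrable_const c)]; simp [hc])
    (show 0 < ε / 4 by positivity)
  have hgm := Lp.aestronglyMeasurable g
  set U := Lp.compMeasurePreservingₗᵢ (E := ℝ) (p := 2) ℝ R hR.toMeasurePreserving with hU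
  refine ⟨hgm.mk, (Lp.memLp g).ae_eq hgm.ae_eq_mk, ?_⟩
  have hae : ∀ᵐ ω ∂μ, (y - (g - U g)) ω = s ω - c - (hgm.mk g ω - hgm.mk g (R ω)) := by
    filter_upwards [hyae, Lp.coeFn_sub y (g - U g), Lp.coeFn_sub g (U g), hgm.ae_eq_mk,
      Lp.coeFn_compMeasurePreserving g hR.toMeasurePreserving,
      hR.quasiMeasurePreserving.ae hgm.ae_eq_mk] with ω h1 h2 h3 h4 h5 h6
    have h5' : (U g) ω = g (R ω) := h5
    rw [h2, Pi.sub_apply, h3, Pi.sub_apply, h1, h5', ← h4, ← h6]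
  have hle : ∀ᵐ ω ∂μ, |Y ω - (hgm.mk g ω - hgm.mk g (R ω))|
      ≤ |Y ω - s ω| + |c| + |(y - (g - U g)) ω| := by
    filter_upwards [hae] with ω hω
    rw [hω]
    have := abs_add_three (Y ω - s ω) c (s ω - c - (hgm.mk g ω - hgm.mk g (R ω)))
    refine le_trans (le_of_eq ?_) this
    congr 1; ring
  have hint : Integrable (y - (g - U g) : Lp ℝ 2 μ) μ := (Lp.memLp _).integrable (by norm_num)
  have i1 : Integrable (fun ω => |Y ω - s ω|) μ := (hY.sub hsi).abs
  calc ∫ ω, |Y ω - (hgm.mk g ω - hgm.mk g (R ω))| ∂μ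
      ≤ ∫ ω, (|Y ω - s ω| + |c| + |(y - (g - U g)) ω|) ∂μ := by
        refine integral_mono_of_nonneg (ae_of_all _ fun _ => abs_nonneg _) ?_ hle
        exact (i1.add (integrable_const _)).add hint.abs
    _ = ∫ ω, |Y ω - s ω| ∂μ + |c| + ∫ ω, |(y - (g - U g)) ω| ∂μ := by
        have i2 : Integrable (fun ω => |Y ω - s ω| + |c|) μ := i1.add (integrable_const _)
        rw [integral_add i2 hint.abs, integral_add i1 (integrable_const _)]
        simp
    _ < ε / 4 + ε / 4 + ε / 4 := by
        have := integral_abs_le_norm_Lp (y - (g - U g))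
        linarith
    _ ≤ ε := by linarith

lemma norm_exp_sub_exp_le (a b : ℝ) :
    ‖Complex.exp (a * Complex.I) - Complex.exp (b * Complex.I)‖ ≤ |a - b| := by
  have h : Complex.exp (a * Complex.I) - Complex.exp (b * Complex.I)
      = Complex.exp (b * Complex.I) * (Complex.exp (Complex.I * ((a - b : ℝ) : ℂ)) - 1) := by
    rw [mul_sub, ← Complex.exp_add]
    push_cast
    ring_nf
  rw [h, norm_mul, Complex.norm_exp_ofReal_mul_I, one_mul]
  exact Real.norm_exp_I_mul_ofReal_sub_one_le

/-- The second order Taylor remainder of `x ↦ exp (i x)`. -/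
noncomputable def expRemainder (x : ℝ) : ℂ :=
  Complex.exp (x * Complex.I) - 1 - x * Complex.I + (x : ℂ) ^ 2 / 2

lemma continuous_expRemainder : Continuous expRemainder := by
  unfold expRemainder; fun_prop

lemma norm_expRemainder_le_cube {x : ℝ} (hx : |x| ≤ 1) : ‖expRemainder x‖ ≤ |x| ^ 3 := by
  have h := Complex.exp_bound (x := x * Complex.I) (by simpa using hx) (n := 3) (by norm_num)
  have h2 : expRemainder x = Complex.exp (x * Complex.I)
      - ∑ m ∈ Finset.range 3, (x * Complex.I) ^ m / (m.factorial : ℂ) := by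
    simp [expRemainder, Finset.sum_range_succ, Nat.factorial, mul_pow]
    ring
  rw [h2]
  refine h.trans ?_
  have : ‖(x : ℂ) * Complex.I‖ = |x| := by simp
  rw [this]
  have h3 : ((Nat.succ 3 : ℕ) : ℝ) * ((Nat.factorial 3 : ℕ) * (3 : ℕ) : ℝ)⁻¹ ≤ 1 := by
    norm_num [Nat.factorial]
  nlinarith [pow_nonneg (abs_nonneg x) 3]

lemma norm_expRemainder_le_sq (x : ℝ) : ‖expRemainder x‖ ≤ 4 * x ^ 2 := by
  rcases le_total |x| 1 with hx | hx
  · refine (norm_expRemainder_le_cube hx).trans ?_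
    rw [← sq_abs]
    nlinarith [sq_nonneg |x|, abs_nonneg x]
  · have h : ‖expRemainder x‖ ≤ 1 + 1 + |x| + |x| ^ 2 / 2 := by
      unfold expRemainder
      refine (norm_add_le _ _).trans (add_le_add ((norm_sub_le _ _).trans (add_le_add
        ((norm_sub_le _ _).trans (add_le_add ?_ ?_)) ?_)) ?_)
      · rw [Complex.norm_exp_ofReal_mul_I]
      · simp
      · simp
      · simp
    rw [← sq_abs]
    nlinarith [abs_nonneg x]

lemma tendsto_mul_norm_expRemainder (s : ℝ) :
    Tendsto (fun n : ℕ => (n : ℝ) * ‖expRemainder (s / √n)‖) atTop (𝓝 0) := by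
  have hsqrt : Tendsto (fun n : ℕ => √(n : ℝ)) atTop atTop :=
    Real.tendsto_sqrt_atTop.comp tendsto_natCast_atTop_atTop
  have h1 : Tendsto (fun n : ℕ => |s| ^ 3 / √(n : ℝ)) atTop (𝓝 0) :=
    tendsto_const_nhds.div_atTop hsqrt
  refine squeeze_zero' (Eventually.of_forall fun n => by positivity) ?_ h1
  filter_upwards [hsqrt.eventually_ge_atTop (max 1 |s|)] with n hn
  have hn1 : 0 < √(n : ℝ) := lt_of_lt_of_le one_pos ((le_max_left _ _).trans hn)
  have h2 : |s / √n| ≤ 1 := by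
    rw [abs_div, abs_of_pos hn1, div_le_one hn1]
    exact (le_max_right _ _).trans hn
  have h3 : (n : ℝ) = √n ^ 2 := (Real.sq_sqrt (Nat.cast_nonneg n)).symm
  calc (n : ℝ) * ‖expRemainder (s / √n)‖ ≤ n * |s / √n| ^ 3 := by
        gcongr; exact norm_expRemainder_le_cube h2
    _ = √n ^ 2 * (|s| / √n) ^ 3 := by rw [← h3, abs_div, abs_of_pos hn1]
    _ = |s| ^ 3 / √n := by field_simp

lemma tendsto_integral_expRemainder {X : Ω → ℝ} (hXm : Measurable X) (hX : MemLp X 2 μ) (t : ℝ) :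
    Tendsto (fun n : ℕ => (n : ℝ) * ∫ ω, ‖expRemainder (t / √n * X ω)‖ ∂μ) atTop (𝓝 0) := by
  simp_rw [← integral_const_mul]
  rw [← integral_zero Ω ℝ (μ := μ)]
  refine tendsto_integral_of_dominated_convergence (fun ω => 4 * (t * X ω) ^ 2) ?_ ?_ ?_ ?_
  · intro n
    exact ((continuous_expRemainder.measurable.comp (hXm.const_mul _)).norm.const_mul
      _).aestronglyMeasurable
  · simp_rw [mul_pow]
    exact (hX.integrable_sq.const_mul _).const_mul _
  · refine fun n => ae_of_all _ fun ω => ?_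
    rw [Real.norm_of_nonneg (by positivity)]
    rcases Nat.eq_zero_or_pos n with rfl | hn
    · simp; positivity
    have hn' : (0 : ℝ) < n := by exact_mod_cast hn
    calc (n : ℝ) * ‖expRemainder (t / √n * X ω)‖ ≤ n * (4 * (t / √n * X ω) ^ 2) := by
          gcongr; exact norm_expRemainder_le_sq _
      _ = 4 * (t * X ω) ^ 2 := by
          rw [mul_pow, div_pow, Real.sq_sqrt hn'.le]; field_simp
  · refine ae_of_all _ fun ω => ?_
    refine (tendsto_mul_norm_expRemainder (t * X ω)).congr fun n => ?_
    congr 3; ring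

variable {X : Ω → ℝ}

lemma measurable_birkhoffSum (hR : Measurable R) (hX : Measurable X) (k : ℕ) :
    Measurable (birkhoffSum R X k) := by
  unfold birkhoffSum
  exact Finset.measurable_sum _ fun i _ => hX.comp (hR.iterate i)

lemma integrable_exp_mul_I [IsProbabilityMeasure μ] {f : Ω → ℝ} (hf : Measurable f) :
    Integrable (fun ω => Complex.exp (f ω * Complex.I)) μ :=
  Integrable.of_bound (Measurable.aestronglyMeasurable (by fun_prop)) 1
    (ae_of_all _ fun ω => by rw [Complex.norm_exp_ofReal_mul_I])

lemma integrable_exp_mul_I_mul {f g : Ω → ℝ} (hf : Measurable f) (hg : Integrable g μ) :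
    Integrable (fun ω => Complex.exp (f ω * Complex.I) * (g ω : ℂ)) μ :=
  hg.ofReal.bdd_mul (Measurable.aestronglyMeasurable (by fun_prop)) (c := 1)
    (ae_of_all _ fun ω => by rw [Complex.norm_exp_ofReal_mul_I])

/-- The partial sums `W_k` and `W_k ∘ R` differ by `X - X ∘ R^k` only, so that the exponential of
the partial sum is almost orthogonal to the coboundaries, uniformly in `k`. -/
lemma norm_integral_exp_mul_coboundary_le [IsProbabilityMeasure μ]
    (hR : MeasurePreserving R μ μ) (hXm : Measurable X) (hX : MemLp X 2 μ)
    {g : Ω → ℝ} (hg : MemLp g 2 μ) (u : ℝ) (k : ℕ) :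
    ‖∫ ω, Complex.exp ((u * birkhoffSum R X k (R ω) : ℝ) * Complex.I) * ((g ω - g (R ω) : ℝ) : ℂ)
      ∂μ‖ ≤ |u| * (∫ ω, X ω ^ 2 ∂μ + ∫ ω, g ω ^ 2 ∂μ) := by
  have hW := measurable_birkhoffSum hR.measurable hXm k
  have hgi : Integrable g μ := hg.integrable (by norm_num)
  have hWR : Measurable fun ω => u * birkhoffSum R X k (R ω) := (hW.comp hR.measurable).const_mul u
  have i1 := integrable_exp_mul_I_mul (μ := μ) hWR hgi
  have i2 := integrable_exp_mul_I_mul (μ := μ) (hW.const_mul u) hgi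
  have i3 : Integrable (fun ω => Complex.exp ((u * birkhoffSum R X k (R ω) : ℝ) * Complex.I)
      * (g (R ω) : ℂ)) μ :=
    integrable_exp_mul_I_mul (μ := μ) hWR (hR.integrable_comp_of_integrable hgi)
  have e1 : ∫ ω, Complex.exp ((u * birkhoffSum R X k (R ω) : ℝ) * Complex.I)
      * (g (R ω) : ℂ) ∂μ
      = ∫ ω, Complex.exp ((u * birkhoffSum R X k ω : ℝ) * Complex.I) * (g ω : ℂ) ∂μ :=
    integral_comp_of_measurePreserving (g := fun ω =>
      Complex.exp ((u * birkhoffSum R X k ω : ℝ) * Complex.I) * (g ω : ℂ)) hR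
      i2.aestronglyMeasurable
  have e2 : ∫ ω, Complex.exp ((u * birkhoffSum R X k (R ω) : ℝ) * Complex.I)
        * ((g ω - g (R ω) : ℝ) : ℂ) ∂μ
      = ∫ ω, (Complex.exp ((u * birkhoffSum R X k (R ω) : ℝ) * Complex.I)
        - Complex.exp ((u * birkhoffSum R X k ω : ℝ) * Complex.I)) * (g ω : ℂ) ∂μ := by
    simp_rw [Complex.ofReal_sub, mul_sub, sub_mul]
    rw [integral_sub i1 i3, integral_sub i1 i2, e1]
  have hRk := hR.iterate k
  have e3 : ∫ ω, X (R^[k] ω) ^ 2 ∂μ = ∫ ω, X ω ^ 2 ∂μ :=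
    integral_comp_of_measurePreserving (g := fun ω => X ω ^ 2) hRk
      (hXm.pow_const 2).aestronglyMeasurable
  have i4 : Integrable (fun ω => X (R^[k] ω) ^ 2) μ :=
    hRk.integrable_comp_of_integrable (g := fun ω => X ω ^ 2) hX.integrable_sq
  have i5 := hX.integrable_sq
  have i6 := hg.integrable_sq
  rw [e2]
  refine (norm_integral_le_integral_norm _).trans ?_
  calc ∫ ω, ‖(Complex.exp ((u * birkhoffSum R X k (R ω) : ℝ) * Complex.I)
        - Complex.exp ((u * birkhoffSum R X k ω : ℝ) * Complex.I)) * (g ω : ℂ)‖ ∂μ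
      ≤ ∫ ω, |u| * ((X (R^[k] ω) ^ 2 / 2 + X ω ^ 2 / 2) + g ω ^ 2) ∂μ := by
        refine integral_mono_of_nonneg (ae_of_all _ fun _ => norm_nonneg _)
          ((((i4.div_const 2).add (i5.div_const 2)).add i6).const_mul _)
          (ae_of_all _ fun ω => ?_)
        simp only [norm_mul, Complex.norm_real, Real.norm_eq_abs]
        have h1 := norm_exp_sub_exp_le (u * birkhoffSum R X k (R ω)) (u * birkhoffSum R X k ω)
        rw [← mul_sub, birkhoffSum_apply_sub_birkhoffSum, abs_mul] at h1
        have h2 : |X (R^[k] ω) - X ω| ≤ |X (R^[k] ω)| + |X ω| := abs_sub _ _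
        have h3 : |X (R^[k] ω) - X ω| * |g ω| ≤ (X (R^[k] ω) ^ 2 / 2 + X ω ^ 2 / 2) + g ω ^ 2 := by
          rw [← sq_abs (X (R^[k] ω)), ← sq_abs (X ω), ← sq_abs (g ω)]
          nlinarith [abs_nonneg (g ω), sq_nonneg (|X (R^[k] ω)| - |g ω|),
            sq_nonneg (|X ω| - |g ω|)]
        calc _ ≤ |u| * |X (R^[k] ω) - X ω| * |g ω| := by gcongr
          _ ≤ _ := by rw [mul_assoc]; gcongr
    _ = |u| * (∫ ω, X ω ^ 2 ∂μ + ∫ ω, g ω ^ 2 ∂μ) := by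
        have i7 : Integrable (fun ω => X (R^[k] ω) ^ 2 / 2 + X ω ^ 2 / 2) μ :=
          (i4.div_const 2).add (i5.div_const 2)
        rw [integral_const_mul, integral_add i7 i6,
          integral_add (i4.div_const 2) (i5.div_const 2), integral_div, integral_div, e3]
        ring

/-- Uniformly in the length `k` of the partial sum, the exponential of `i u` times the partial sum
decorrelates from the fluctuation of `X ^ 2` as `u → 0`. -/
lemma exists_norm_integral_exp_mul_sq_sub_le [IsProbabilityMeasure μ]
    (hR : Ergodic R μ) (hXm : Measurable X) (hX : MemLp X 2 μ) {ε : ℝ} (hε : 0 < ε) :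
    ∃ C, ∀ (u : ℝ) (k : ℕ),
      ‖∫ ω, Complex.exp ((u * birkhoffSum R X k (R ω) : ℝ) * Complex.I)
        * ((X ω ^ 2 - ∫ ω', X ω' ^ 2 ∂μ : ℝ) : ℂ) ∂μ‖ ≤ ε + C * |u| := by
  set v := ∫ ω', X ω' ^ 2 ∂μ with hv
  have hYi : Integrable (fun ω => X ω ^ 2 - v) μ := hX.integrable_sq.sub (integrable_const v)
  obtain ⟨g, hg, hgε⟩ := exists_coboundary_approx hR hYi
    (by rw [integral_sub hX.integrable_sq (integrable_const v)]; simp [hv]) hε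
  refine ⟨v + ∫ ω, g ω ^ 2 ∂μ, fun u k => ?_⟩
  have hmp := hR.toMeasurePreserving
  have hWR : Measurable fun ω => u * birkhoffSum R X k (R ω) :=
    ((measurable_birkhoffSum hmp.measurable hXm k).comp hmp.measurable).const_mul u
  have hgi : Integrable g μ := hg.integrable (by norm_num)
  have hgc : Integrable (fun ω => g ω - g (R ω)) μ :=
    hgi.sub (hmp.integrable_comp_of_integrable hgi)
  have hYg : Integrable (fun ω => X ω ^ 2 - v - (g ω - g (R ω))) μ := hYi.sub hgc
  have i1 := integrable_exp_mul_I_mul (μ := μ) hWR hYg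
  have i2 := integrable_exp_mul_I_mul (μ := μ) hWR hgc
  have hsplit : ∫ ω, Complex.exp ((u * birkhoffSum R X k (R ω) : ℝ) * Complex.I)
        * ((X ω ^ 2 - v : ℝ) : ℂ) ∂μ
      = (∫ ω, Complex.exp ((u * birkhoffSum R X k (R ω) : ℝ) * Complex.I)
          * (((X ω ^ 2 - v) - (g ω - g (R ω)) : ℝ) : ℂ) ∂μ)
        + ∫ ω, Complex.exp ((u * birkhoffSum R X k (R ω) : ℝ) * Complex.I)
          * ((g ω - g (R ω) : ℝ) : ℂ) ∂μ := by
    rw [← integral_add i1 i2]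
    refine integral_congr_ae (ae_of_all _ fun ω => ?_)
    push_cast; ring
  rw [hsplit]
  refine (norm_add_le _ _).trans (add_le_add ?_ ?_)
  · refine (norm_integral_le_integral_norm _).trans (le_trans (le_of_eq ?_) hgε.le)
    refine integral_congr_ae (ae_of_all _ fun ω => ?_)
    simp only [norm_mul, Complex.norm_exp_ofReal_mul_I, Complex.norm_real, Real.norm_eq_abs,
      one_mul]
  · rw [mul_comm]
    exact norm_integral_exp_mul_coboundary_le hmp hXm hX hg u k

lemma norm_sub_pow_le_of_recursion {φ : ℕ → ℂ} {a : ℂ} (ha : ‖a‖ ≤ 1) {δ : ℝ} (h0 : φ 0 = 1)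
    (h : ∀ k, ‖φ (k + 1) - a * φ k‖ ≤ δ) (n : ℕ) : ‖φ n - a ^ n‖ ≤ n * δ := by
  induction n with
  | zero => simp [h0]
  | succ n ih =>
    have : φ (n + 1) - a ^ (n + 1) = (φ (n + 1) - a * φ n) + a * (φ n - a ^ n) := by ring
    rw [this]
    refine (norm_add_le _ _).trans ?_
    rw [norm_mul]
    push_cast
    have h1 := h n
    have h2 : ‖a‖ * ‖φ n - a ^ n‖ ≤ 1 * (n * δ) := by gcongr
    linarith

/-- One step of the recursion for the characteristic functions of the partial sums: the first
order term of the expansion of the last factor vanishes by hypothesis. -/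
lemma norm_integral_exp_birkhoffSum_succ_sub_le [IsProbabilityMeasure μ]
    (hR : Ergodic R μ) (hXm : Measurable X) (hX : MemLp X 2 μ)
    (hmart : ∀ (u : ℝ) (k : ℕ),
      ∫ ω, Complex.exp ((u * birkhoffSum R X k (R ω) : ℝ) * Complex.I) * (X ω : ℂ) ∂μ = 0)
    (u : ℝ) (k : ℕ) :
    ‖(∫ ω, Complex.exp ((u * birkhoffSum R X (k + 1) ω : ℝ) * Complex.I) ∂μ)
      - (1 - u ^ 2 * (∫ ω, X ω ^ 2 ∂μ) / 2 : ℝ)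
        * ∫ ω, Complex.exp ((u * birkhoffSum R X k ω : ℝ) * Complex.I) ∂μ‖
      ≤ u ^ 2 / 2 * ‖∫ ω, Complex.exp ((u * birkhoffSum R X k (R ω) : ℝ) * Complex.I)
        * ((X ω ^ 2 - ∫ ω', X ω' ^ 2 ∂μ : ℝ) : ℂ) ∂μ‖ + ∫ ω, ‖expRemainder (u * X ω)‖ ∂μ := by
  set v := ∫ ω', X ω' ^ 2 ∂μ with hv
  clear_value v
  have hmp := hR.toMeasurePreserving
  have hW := measurable_birkhoffSum hmp.measurable hXm k
  have hWR : Measurable fun ω => u * birkhoffSum R X k (R ω) :=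
    (hW.comp hmp.measurable).const_mul u
  have hXi : Integrable X μ := hX.integrable (by norm_num)
  have hYi : Integrable (fun ω => X ω ^ 2 - v) μ := hX.integrable_sq.sub (integrable_const v)
  have i1 := integrable_exp_mul_I (μ := μ) hWR
  have i2 := integrable_exp_mul_I_mul (μ := μ) hWR hXi
  have i3 := integrable_exp_mul_I_mul (μ := μ) hWR hYi
  have hrem : Integrable (fun ω => expRemainder (u * X ω)) μ := by
    refine Integrable.mono' ((hX.integrable_sq.const_mul (u ^ 2)).const_mul 4)
      ((continuous_expRemainder.measurable.comp (hXm.const_mul _)).aestronglyMeasurable)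
      (ae_of_all _ fun ω => ?_)
    simpa [mul_pow] using norm_expRemainder_le_sq (u * X ω)
  have i4 : Integrable (fun ω => Complex.exp ((u * birkhoffSum R X k (R ω) : ℝ) * Complex.I)
      * expRemainder (u * X ω)) μ :=
    hrem.bdd_mul (Measurable.aestronglyMeasurable (by fun_prop)) (c := 1)
      (ae_of_all _ fun ω => by rw [Complex.norm_exp_ofReal_mul_I])
  have e1 : ∫ ω, Complex.exp ((u * birkhoffSum R X k ω : ℝ) * Complex.I) ∂μ
      = ∫ ω, Complex.exp ((u * birkhoffSum R X k (R ω) : ℝ) * Complex.I) ∂μ :=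
    (integral_comp_of_measurePreserving (g := fun ω =>
      Complex.exp ((u * birkhoffSum R X k ω : ℝ) * Complex.I)) hmp
      (integrable_exp_mul_I (hW.const_mul u)).aestronglyMeasurable).symm
  have e2 : ∫ ω, Complex.exp ((u * birkhoffSum R X (k + 1) ω : ℝ) * Complex.I) ∂μ
      = (1 - u ^ 2 * v / 2 : ℝ)
          * (∫ ω, Complex.exp ((u * birkhoffSum R X k (R ω) : ℝ) * Complex.I) ∂μ)
        + (u * Complex.I) * (∫ ω, Complex.exp ((u * birkhoffSum R X k (R ω) : ℝ) * Complex.I)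
            * (X ω : ℂ) ∂μ)
        - (u ^ 2 / 2 : ℝ) * (∫ ω, Complex.exp ((u * birkhoffSum R X k (R ω) : ℝ) * Complex.I)
            * ((X ω ^ 2 - v : ℝ) : ℂ) ∂μ)
        + ∫ ω, Complex.exp ((u * birkhoffSum R X k (R ω) : ℝ) * Complex.I)
            * expRemainder (u * X ω) ∂μ := by
    have j1 := i1.const_mul ((1 - u ^ 2 * v / 2 : ℝ) : ℂ)
    have j2 := i2.const_mul (u * Complex.I)
    have j3 := i3.const_mul ((u ^ 2 / 2 : ℝ) : ℂ)
    rw [← integral_const_mul, ← integral_const_mul, ← integral_const_mul, ← integral_add' j1 j2,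
      ← integral_sub' (j1.add j2) j3, ← integral_add' ((j1.add j2).sub j3) i4]
    refine integral_congr_ae (ae_of_all _ fun ω => ?_)
    simp only [birkhoffSum_succ', Pi.add_apply, Pi.sub_apply]
    rw [show ((u * (X ω + birkhoffSum R X k (R ω)) : ℝ) : ℂ) * Complex.I
      = (u * birkhoffSum R X k (R ω) : ℝ) * Complex.I + (u * X ω : ℝ) * Complex.I by
        push_cast; ring, Complex.exp_add]
    simp only [expRemainder]
    push_cast
    ring
  rw [e1, e2, hmart u k, mul_zero, add_zero]
  rw [show ∀ a b c : ℂ, a - b + c - a = -b + c by intros; ring]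
  refine (norm_add_le _ _).trans (add_le_add ?_ ?_)
  · rw [norm_neg, norm_mul, Complex.norm_real, Real.norm_of_nonneg (by positivity)]
  · refine (norm_integral_le_integral_norm _).trans (le_of_eq ?_)
    refine integral_congr_ae (ae_of_all _ fun ω => ?_)
    simp only [norm_mul, Complex.norm_exp_ofReal_mul_I, one_mul]

/-- Central limit theorem for (reversed) stationary ergodic martingale differences, in terms of
characteristic functions. The martingale property enters only through `hmart`. -/
theorem tendsto_integral_exp_birkhoffSum [IsProbabilityMeasure μ]
    (hR : Ergodic R μ) (hXm : Measurable X) (hX : MemLp X 2 μ)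
    (hmart : ∀ (u : ℝ) (k : ℕ),
      ∫ ω, Complex.exp ((u * birkhoffSum R X k (R ω) : ℝ) * Complex.I) * (X ω : ℂ) ∂μ = 0)
    (t : ℝ) :
    Tendsto (fun n : ℕ =>
        ∫ ω, Complex.exp ((t / √n * birkhoffSum R X n ω : ℝ) * Complex.I) ∂μ) atTop
      (𝓝 (Complex.exp (-(t ^ 2 * ∫ ω, X ω ^ 2 ∂μ) / 2 : ℝ))) := by
  set v := ∫ ω', X ω' ^ 2 ∂μ with hv
  have hv0 : 0 ≤ v := integral_nonneg fun _ => sq_nonneg _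
  have hsqrt : Tendsto (fun n : ℕ => √(n : ℝ)) atTop atTop :=
    Real.tendsto_sqrt_atTop.comp tendsto_natCast_atTop_atTop
  have hpow : Tendsto (fun n : ℕ => ((1 - (t / √n) ^ 2 * v / 2 : ℝ) : ℂ) ^ n) atTop
      (𝓝 (Complex.exp (-(t ^ 2 * v) / 2 : ℝ))) := by
    rw [← Complex.ofReal_exp]
    have h := (Real.tendsto_one_add_div_pow_exp (-(t ^ 2 * v) / 2))
    refine ((Complex.continuous_ofReal.tendsto _).comp h).congr fun n => ?_
    simp only [Function.comp_apply, Complex.ofReal_pow]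
    congr 2
    rw [div_pow, Real.sq_sqrt (Nat.cast_nonneg n)]
    ring
  suffices hdiff : Tendsto (fun n : ℕ =>
      (∫ ω, Complex.exp ((t / √n * birkhoffSum R X n ω : ℝ) * Complex.I) ∂μ)
        - ((1 - (t / √n) ^ 2 * v / 2 : ℝ) : ℂ) ^ n) atTop (𝓝 0) by
    simpa using hdiff.add hpow
  rw [Metric.tendsto_atTop']
  intro η hη
  -- the fluctuation of `X ^ 2` contributes at most `t² ε / 2`
  set ε := η / (t ^ 2 + 1) with hεdef
  have hε : 0 < ε := by positivity
  obtain ⟨C, hC⟩ := exists_norm_integral_exp_mul_sq_sub_le hR hXm hX hε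
  have hlim : Tendsto (fun n : ℕ => t ^ 2 / 2 * (ε + C * (|t| / √n))
      + n * ∫ ω, ‖expRemainder (t / √n * X ω)‖ ∂μ) atTop (𝓝 (t ^ 2 / 2 * (ε + C * 0) + 0)) := by
    refine Tendsto.add (Tendsto.const_mul _ (Tendsto.const_add _ (Tendsto.const_mul _ ?_)))
      (tendsto_integral_expRemainder hXm hX t)
    exact tendsto_const_nhds.div_atTop hsqrt
  have hlt : t ^ 2 / 2 * (ε + C * 0) + 0 < η := by
    have : (t ^ 2 + 1) * ε = η := by rw [hεdef]; field_simp
    nlinarith [sq_nonneg t]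
  have hbig : ∀ᶠ n : ℕ in atTop, t ^ 2 * v / 2 ≤ n :=
    tendsto_natCast_atTop_atTop.eventually_ge_atTop _
  obtain ⟨n₀, hn₀⟩ := eventually_atTop.1
    ((hlim.eventually_lt_const hlt).and (hbig.and (eventually_gt_atTop 0)))
  refine ⟨n₀, fun n hn => ?_⟩
  obtain ⟨h1, h2, h3⟩ := hn₀ n hn.le
  have hn' : (0 : ℝ) < n := by exact_mod_cast h3
  rw [dist_zero_right]
  have hu2 : (t / √n) ^ 2 = t ^ 2 / n := by rw [div_pow, Real.sq_sqrt hn'.le]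
  have ha : ‖((1 - (t / √n) ^ 2 * v / 2 : ℝ) : ℂ)‖ ≤ 1 := by
    rw [Complex.norm_real, Real.norm_eq_abs, abs_le, hu2]
    have h5 : t ^ 2 / n * v / 2 ≤ 1 := by
      rw [show t ^ 2 / n * v / 2 = (t ^ 2 * v / 2) / n by ring]
      exact (div_le_one hn').2 h2
    have h6 : 0 ≤ t ^ 2 / n * v / 2 := by positivity
    constructor <;> linarith
  have hrec := norm_sub_pow_le_of_recursion
    (φ := fun k => ∫ ω, Complex.exp ((t / √n * birkhoffSum R X k ω : ℝ) * Complex.I) ∂μ)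
    (a := ((1 - (t / √n) ^ 2 * v / 2 : ℝ) : ℂ)) ha (by simp)
    (δ := (t / √n) ^ 2 / 2 * (ε + C * |t / √n|) + ∫ ω, ‖expRemainder (t / √n * X ω)‖ ∂μ)
    (fun k => (norm_integral_exp_birkhoffSum_succ_sub_le hR hXm hX hmart (t / √n) k).trans
      (by gcongr; exact hC _ _)) n
  refine lt_of_le_of_lt hrec (lt_of_le_of_lt (le_of_eq ?_) h1)
  rw [hu2, abs_div, abs_of_nonneg (Real.sqrt_nonneg _)]
  field_simp

end CLT

/-! ### Orthogonal series in Hilbert spaces -/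

section Hilbert

variable {ι H : Type*} [NormedAddCommGroup H] [InnerProductSpace ℝ H]

lemma norm_sq_sum_smul {w : ι → H} (hw : ∀ i j, i ≠ j → inner ℝ (w i) (w j) = 0)
    (s : Finset ι) (c : ι → ℝ) :
    ‖∑ i ∈ s, c i • w i‖ ^ 2 = ∑ i ∈ s, c i ^ 2 * ‖w i‖ ^ 2 := by
  rw [← real_inner_self_eq_norm_sq, sum_inner]
  refine Finset.sum_congr rfl fun a ha => ?_
  rw [inner_sum, Finset.sum_eq_single_of_mem a ha]
  · rw [inner_smul_left, inner_smul_right, real_inner_self_eq_norm_sq]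
    simp
    ring
  · intro b _ hb
    rw [inner_smul_left, inner_smul_right, hw a b hb.symm]
    simp

/-- The remainders of an orthogonal series are bounded uniformly in the orthogonal family. -/
lemma norm_sub_sum_sq_le {w : ι → H} (hw : ∀ i j, i ≠ j → inner ℝ (w i) (w j) = 0)
    (hw1 : ∀ i, ‖w i‖ ≤ 1) {c : ι → ℝ} (hc : Summable fun i => c i ^ 2) {x : H}
    (hx : HasSum (fun i => c i • w i) x) (s : Finset ι) :
    ‖x - ∑ i ∈ s, c i • w i‖ ^ 2 ≤ ∑' i, c i ^ 2 - ∑ i ∈ s, c i ^ 2 := by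
  classical
  have h1 : Tendsto (fun u : Finset ι => ‖∑ i ∈ u, c i • w i - ∑ i ∈ s, c i • w i‖ ^ 2) atTop
      (𝓝 (‖x - ∑ i ∈ s, c i • w i‖ ^ 2)) := ((hx.sub_const _).norm).pow 2
  have h2 : Tendsto (fun u : Finset ι => ∑ i ∈ u, c i ^ 2 - ∑ i ∈ s, c i ^ 2) atTop
      (𝓝 (∑' i, c i ^ 2 - ∑ i ∈ s, c i ^ 2)) := hc.hasSum.sub_const _
  refine le_of_tendsto_of_tendsto h1 h2 ?_
  filter_upwards [eventually_ge_atTop s] with u hu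
  rw [← Finset.sum_sdiff hu, ← Finset.sum_sdiff hu, add_sub_cancel_right, add_sub_cancel_right,
    norm_sq_sum_smul hw]
  refine Finset.sum_le_sum fun i _ => ?_
  have := pow_le_one₀ (norm_nonneg _) (hw1 i) (n := 2)
  nlinarith [sq_nonneg (c i)]

lemma exists_finset_tsum_sub_le {c : ι → ℝ} (hc : Summable c) {ε : ℝ} (hε : 0 < ε) :
    ∃ s : Finset ι, ∑' i, c i - ∑ i ∈ s, c i ≤ ε := by
  obtain ⟨s, hs⟩ := (hc.hasSum.eventually_const_lt
    (show ∑' i, c i - ε < ∑' i, c i by linarith)).exists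
  exact ⟨s, by linarith⟩

lemma Orthonormal.summable_smul [CompleteSpace H] {w : ι → H} (hw : Orthonormal ℝ w) {c : ι → ℝ}
    (hc : Summable fun i => c i ^ 2) : Summable fun i => c i • w i := by
  have h := (hw.orthogonalFamily.summable_iff_norm_sq_summable c).2 (by simpa using hc)
  simpa using h

/-- Expansion of a vector along a family whose members are pairwise orthogonal and of norm
one or zero. -/
lemma hasSum_inner_smul_of_mem_closure [CompleteSpace H] {w : ι → H}
    (hw : ∀ i j, i ≠ j → inner ℝ (w i) (w j) = 0) (hw1 : ∀ i, w i = 0 ∨ ‖w i‖ = 1) {x : H}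
    (hx : x ∈ (Submodule.span ℝ (Set.range w)).topologicalClosure) :
    (Summable fun i => inner ℝ (w i) x ^ 2) ∧ HasSum (fun i => (inner ℝ (w i) x : ℝ) • w i) x := by
  classical
  set t : Set ι := {i | w i ≠ 0}
  have ho : Orthonormal ℝ (fun i : t => w i) :=
    ⟨fun i => (hw1 i).resolve_left i.2, fun i j hij => hw i j fun h => hij (Subtype.ext h)⟩
  have h0 : ∀ i ∉ t, w i = 0 := fun i hi => by simpa [t] using hi
  have hs1 : Summable fun i : t => inner ℝ (w i) x ^ 2 := by
    simpa using ho.inner_products_summable (x := x)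
  have hs2 : Summable fun i : t => (inner ℝ (w i) x : ℝ) • w i :=
    Orthonormal.summable_smul ho hs1
  have hs3 : Summable fun i => (inner ℝ (w i) x : ℝ) • w i := by
    rw [← Function.Injective.summable_iff (Subtype.val_injective (p := fun i => i ∈ t))]
    · exact hs2
    · intro i hi
      rw [h0 i (by simpa using hi), smul_zero]
  refine ⟨?_, ?_⟩
  · rw [← Function.Injective.summable_iff (Subtype.val_injective (p := fun i => i ∈ t))]
    · exact hs1
    · intro i hi
      rw [h0 i (by simpa using hi)]
      simp
  · obtain ⟨y, hy⟩ := hs3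
    suffices hxy : x - y = 0 by
      rw [sub_eq_zero.1 hxy]
      rwa [sub_eq_zero.1 hxy] at hy
    have horth : ∀ i, inner ℝ (w i) (x - y) = 0 := by
      intro i
      have h1 : HasSum (fun j => inner ℝ (w i) ((inner ℝ (w j) x : ℝ) • w j)) (inner ℝ (w i) y) :=
        hy.mapL (innerSL ℝ (w i))
      have h2 : HasSum (fun j => inner ℝ (w i) ((inner ℝ (w j) x : ℝ) • w j))
          (inner ℝ (w i) x) := by
        convert hasSum_single i ?_ using 1
        · rw [inner_smul_right, real_inner_self_eq_norm_sq]
          rcases hw1 i with h | h <;> simp [h]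
        · intro j hj
          rw [inner_smul_right, hw i j hj.symm, mul_zero]
      rw [inner_sub_right, h1.unique h2, sub_self]
    have hy' : y ∈ (Submodule.span ℝ (Set.range w)).topologicalClosure :=
      Submodule.isClosed_topologicalClosure _ |>.mem_of_tendsto hy <| Eventually.of_forall fun s =>
        Submodule.le_topologicalClosure _ <| Submodule.sum_mem _ fun i _ =>
          Submodule.smul_mem _ _ (Submodule.subset_span ⟨i, rfl⟩)
    have hperp : x - y ∈ (Submodule.span ℝ (Set.range w)).topologicalClosureᗮ := by
      rw [Submodule.orthogonal_closure, Submodule.mem_orthogonal]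
      intro u hu
      induction hu using Submodule.span_induction with
      | mem u hu => obtain ⟨i, rfl⟩ := hu; exact horth i
      | zero => simp
      | add u v _ _ hu hv => rw [inner_add_left, hu, hv, add_zero]
      | smul c u _ hu => rw [inner_smul_left, hu, mul_zero]
    exact inner_self_eq_zero.1 ((Submodule.mem_orthogonal _ _).1 hperp _
      (Submodule.sub_mem _ hx hy'))

end Hilbert

/-! ### Conditional expectation and orthogonality -/

section CondExp

variable {Ω : Type*} {m mΩ : MeasurableSpace Ω} {μ : Measure Ω} [IsProbabilityMeasure μ]

lemma integral_mul_eq_zero_of_condExp_eq_zero (hm : m ≤ mΩ) {f g : Ω → ℝ} (hf : MemLp f 2 μ)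
    (hf0 : μ[f | m] =ᵐ[μ] 0) (hg : AEStronglyMeasurable[m] g μ) (hg2 : MemLp g 2 μ) :
    ∫ ω, f ω * g ω ∂μ = 0 := by
  have hfg : Integrable (f * g) μ := hf.integrable_mul hg2
  have h := condExp_mul_of_aestronglyMeasurable_right hg hfg (hf.integrable (by norm_num))
  have h2 : ∫ ω, (f * g) ω ∂μ = ∫ ω, (μ[f * g | m]) ω ∂μ := (integral_condExp hm).symm
  rw [show ∫ ω, f ω * g ω ∂μ = ∫ ω, (f * g) ω ∂μ from rfl, h2, integral_congr_ae h,
    ← integral_zero Ω ℝ (μ := μ)]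
  refine integral_congr_ae ?_
  filter_upwards [hf0] with ω hω
  simp [hω]

lemma inner_eq_zero_of_condExp_eq_zero (hm : m ≤ mΩ) {x y : Lp ℝ 2 μ} (hx : μ[x | m] =ᵐ[μ] 0)
    (hy : AEStronglyMeasurable[m] y μ) : inner ℝ x y = 0 := by
  have := integral_mul_eq_zero_of_condExp_eq_zero hm (Lp.memLp x) hx hy (Lp.memLp y)
  rw [L2.inner_def]
  simpa [mul_comm] using this

lemma integral_exp_mul_eq_zero_of_condExp_eq_zero (hm : m ≤ mΩ) {f g : Ω → ℝ} (hf : MemLp f 2 μ)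
    (hf0 : μ[f | m] =ᵐ[μ] 0) (hg : Measurable[m] g) :
    ∫ ω, Complex.exp (g ω * Complex.I) * (f ω : ℂ) ∂μ = 0 := by
  have hc : Measurable[m] fun ω => Real.cos (g ω) := Real.measurable_cos.comp hg
  have hs : Measurable[m] fun ω => Real.sin (g ω) := Real.measurable_sin.comp hg
  have hc2 : MemLp (fun ω => Real.cos (g ω)) 2 μ :=
    MemLp.of_bound (hc.mono hm le_rfl).aestronglyMeasurable 1
      (ae_of_all _ fun ω => by simpa using Real.abs_cos_le_one _)
  have hs2 : MemLp (fun ω => Real.sin (g ω)) 2 μ :=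
    MemLp.of_bound (hs.mono hm le_rfl).aestronglyMeasurable 1
      (ae_of_all _ fun ω => by simpa using Real.abs_sin_le_one _)
  have h1 := integral_mul_eq_zero_of_condExp_eq_zero hm hf hf0
    hc.stronglyMeasurable.aestronglyMeasurable hc2
  have h2 := integral_mul_eq_zero_of_condExp_eq_zero hm hf hf0
    hs.stronglyMeasurable.aestronglyMeasurable hs2
  have i1 : Integrable (fun ω => ((f ω * Real.cos (g ω) : ℝ) : ℂ)) μ :=
    (hf.integrable_mul hc2).ofReal
  have i2 : Integrable (fun ω => ((f ω * Real.sin (g ω) : ℝ) : ℂ)) μ :=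
    (hf.integrable_mul hs2).ofReal
  have h3 : ∀ ω, Complex.exp (g ω * Complex.I) * (f ω : ℂ)
      = ((f ω * Real.cos (g ω) : ℝ) : ℂ) + ((f ω * Real.sin (g ω) : ℝ) : ℂ) * Complex.I := by
    intro ω
    rw [Complex.exp_mul_I]
    push_cast
    ring
  simp_rw [h3]
  rw [integral_add i1 (i2.mul_const _), integral_mul_const, integral_complex_ofReal,
    integral_complex_ofReal, h1, h2]
  simp

end CondExp

/-- The joint law of the scaled independent Gaussian variables `σ a * N a`, through its
characteristic function. -/
lemma charFun_map_toLp_gaussian {Ω' ι : Type*} [Fintype ι] [MeasurableSpace Ω'] {P : Measure Ω'}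
    [IsProbabilityMeasure P] {N : ι → Ω' → ℝ} (hN : ∀ a, HasLaw (N a) (gaussianReal 0 1) P)
    (hind : iIndepFun N P) (σ : ι → ℝ) (θ : EuclideanSpace ℝ ι) :
    charFun (P.map fun ω => WithLp.toLp 2 fun a => σ a * N a ω) θ
      = Complex.exp (-(∑ a, θ a ^ 2 * σ a ^ 2) / 2 : ℝ) := by
  have hσ := fun a => gaussianReal_const_mul (hN a) (σ a)
  have hind' : iIndepFun (fun a ω => σ a * N a ω) P :=
    hind.comp (fun a x => σ a * x) fun a => by fun_prop
  rw [(iIndepFun_iff_charFun_pi fun a => (hσ a).aemeasurable).1 hind' θ]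
  simp_rw [fun a => (hσ a).map_eq, charFun_gaussianReal]
  rw [← Complex.exp_sum]
  congr 1
  push_cast
  rw [← Finset.sum_neg_distrib, Finset.sum_div]
  refine Finset.sum_congr rfl fun a _ => ?_
  simp
  ring

/-! ### One filtered system -/

namespace FilteredSystem

variable {Ω : Type*} [mΩ : MeasurableSpace Ω] (S : FilteredSystem Ω)

lemma iter_zero : S.iter 0 = id := by
  simp [iter]

lemma iter_one : S.iter 1 = S.T := by
  simp [iter]

lemma iter_neg_one : S.iter (-1) = S.T.symm := by
  funext ω
  simp only [iter, zpow_neg_one]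
  rfl

lemma iter_add (i j : ℤ) : S.iter (i + j) = S.iter i ∘ S.iter j := by
  simp [iter, zpow_add]

lemma measurePreserving_iter (i : ℤ) : MeasurePreserving (S.iter i) S.μ S.μ := by
  induction i using Int.induction_on with
  | zero => rw [iter_zero]; exact MeasurePreserving.id _
  | succ i ih =>
    rw [iter_add, iter_one]
    exact ih.comp S.ergodic.toMeasurePreserving
  | pred i ih =>
    rw [sub_eq_add_neg, iter_add, iter_neg_one]
    exact ih.comp S.ergodic.symm.toMeasurePreserving

lemma iter_neg_natCast (n : ℕ) : S.iter (-(n : ℤ)) = S.T.symm^[n] := by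
  induction n with
  | zero => simp [iter_zero]
  | succ n ih =>
    rw [Nat.cast_succ, neg_add, iter_add, ih, iter_neg_one, Function.iterate_succ]

lemma measurable_symm_F₀ : Measurable[S.F₀, S.F₀] S.T.symm := by
  intro A hA
  rw [← S.T.image_eq_preimage_symm]
  exact S.image_mem A hA

lemma filt_neg_le_F₀ (n : ℕ) : S.filt (-(n : ℤ)) ≤ S.F₀ := by
  rw [← measurable_iff_comap_le, iter_neg_natCast]
  exact Measurable.iterate S.measurable_symm_F₀ n

lemma filt_neg_one_le_F₀ : S.filt (-1) ≤ S.F₀ := by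
  simpa using S.filt_neg_le_F₀ 1

lemma filt_neg_succ_le (n : ℕ) : S.filt (-((n + 1 : ℕ) : ℤ)) ≤ S.filt (-1) := by
  rw [show (-((n + 1 : ℕ) : ℤ)) = -(n : ℤ) + -1 by push_cast; ring]
  unfold filt
  rw [iter_add, ← MeasurableSpace.comap_comp]
  exact MeasurableSpace.comap_mono (S.filt_neg_le_F₀ n)

lemma filt_le (i : ℤ) : S.filt i ≤ mΩ :=
  (MeasurableSpace.comap_mono S.F₀_le).trans (S.measurePreserving_iter i).measurable.comap_le

lemma filt_zero : S.filt 0 = S.F₀ := by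
  simp [filt, iter_zero]

/-- The Koopman operator `x ↦ x ∘ T ^ i` on `L²`. -/
noncomputable def koopman (i : ℤ) : Lp ℝ 2 S.μ →L[ℝ] Lp ℝ 2 S.μ :=
  (Lp.compMeasurePreservingₗᵢ ℝ (S.iter i) (S.measurePreserving_iter i)).toContinuousLinearMap

lemma coeFn_koopman (i : ℤ) (x : Lp ℝ 2 S.μ) : S.koopman i x =ᵐ[S.μ] x ∘ S.iter i :=
  Lp.coeFn_compMeasurePreserving x (S.measurePreserving_iter i)

lemma koopman_add (i j : ℤ) (x : Lp ℝ 2 S.μ) :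
    S.koopman (i + j) x = S.koopman j (S.koopman i x) := by
  refine Lp.ext ?_
  filter_upwards [S.coeFn_koopman (i + j) x, S.coeFn_koopman j (S.koopman i x),
    (S.measurePreserving_iter j).quasiMeasurePreserving.ae (S.coeFn_koopman i x)]
    with ω h1 h2 h3
  rw [h1, h2, Function.comp_apply, Function.comp_apply, h3, iter_add]
  rfl

lemma inner_koopman (i : ℤ) (x y : Lp ℝ 2 S.μ) :
    inner ℝ (S.koopman i x) (S.koopman i y) = inner ℝ x y :=
  (Lp.compMeasurePreservingₗᵢ ℝ (S.iter i) (S.measurePreserving_iter i)).inner_map_map x y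

/-- The normalized sums `n^{-1/2} ∑_{j=1}^n x ∘ T ^ j`, as operators on `L²`. -/
noncomputable def normSum (n : ℕ) : Lp ℝ 2 S.μ →L[ℝ] Lp ℝ 2 S.μ :=
  (1 / √(n : ℝ)) • ∑ j ∈ Finset.Icc 1 n, S.koopman (j : ℤ)

lemma normSum_apply (n : ℕ) (x : Lp ℝ 2 S.μ) :
    S.normSum n x = (1 / √(n : ℝ)) • ∑ j ∈ Finset.Icc 1 n, S.koopman (j : ℤ) x := by
  simp [normSum]

/-- The martingale differences of one system: the square integrable functions that are
`F₀`-measurable and have vanishing conditional expectation given `F₋₁`, up to a.e. equality. -/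
noncomputable def martingaleDiff : Submodule ℝ (Lp ℝ 2 S.μ) where
  carrier := {x | AEStronglyMeasurable[S.F₀] x S.μ ∧ S.μ[x | S.filt (-1)] =ᵐ[S.μ] 0}
  add_mem' := by
    rintro x y ⟨hx, hx0⟩ ⟨hy, hy0⟩
    refine ⟨(hx.add hy).congr (Lp.coeFn_add x y).symm, ?_⟩
    refine (condExp_congr_ae (Lp.coeFn_add x y)).trans ((condExp_add
      ((Lp.memLp x).integrable (by norm_num)) ((Lp.memLp y).integrable (by norm_num)) _).trans ?_)
    filter_upwards [hx0, hy0] with ω h1 h2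
    simp [h1, h2]
  zero_mem' := by
    refine ⟨aestronglyMeasurable_const.congr (Lp.coeFn_zero ℝ 2 S.μ).symm, ?_⟩
    refine (condExp_congr_ae (Lp.coeFn_zero ℝ 2 S.μ)).trans ?_
    rw [condExp_zero]
  smul_mem' := by
    rintro c x ⟨hx, hx0⟩
    refine ⟨(hx.const_smul c).congr (Lp.coeFn_smul c x).symm, ?_⟩
    refine (condExp_congr_ae (Lp.coeFn_smul c x)).trans ((condExp_smul c _ _).trans ?_)
    filter_upwards [hx0] with ω h1
    simp [h1]

variable {S}

lemma inner_eq_zero_of_mem_martingaleDiff {x y : Lp ℝ 2 S.μ} (hx : x ∈ S.martingaleDiff)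
    (hy : AEStronglyMeasurable[S.filt (-1)] y S.μ) : inner ℝ x y = 0 :=
  inner_eq_zero_of_condExp_eq_zero (S.filt_le (-1)) hx.2 hy

lemma inner_koopman_neg_eq_zero {x y : Lp ℝ 2 S.μ} (hx : x ∈ S.martingaleDiff)
    (hy : y ∈ S.martingaleDiff) (n : ℕ) :
    inner ℝ x (S.koopman (-((n + 1 : ℕ) : ℤ)) y) = 0 := by
  refine inner_eq_zero_of_mem_martingaleDiff hx ?_
  obtain ⟨g, hg, hyg⟩ := hy.1
  refine ⟨g ∘ S.iter (-((n + 1 : ℕ) : ℤ)), ?_, ?_⟩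
  · exact (hg.comp_measurable (comap_measurable _)).mono (S.filt_neg_succ_le n)
  · exact (S.coeFn_koopman _ y).trans
      ((S.measurePreserving_iter _).quasiMeasurePreserving.ae_eq_comp hyg)

/-- The shifts of martingale differences by different times are orthogonal. -/
lemma inner_koopman_koopman_of_ne {x y : Lp ℝ 2 S.μ} (hx : x ∈ S.martingaleDiff)
    (hy : y ∈ S.martingaleDiff) {i j : ℤ} (hij : i ≠ j) :
    inner ℝ (S.koopman i x) (S.koopman j y) = 0 := by
  wlog h : j < i generalizing i j x y
  · rw [real_inner_comm]
    exact this hy hx hij.symm (lt_of_le_of_ne (not_lt.1 h) hij)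
  obtain ⟨n, rfl⟩ : ∃ n : ℕ, j = -((n + 1 : ℕ) : ℤ) + i := ⟨(i - j - 1).toNat, by omega⟩
  rw [koopman_add, inner_koopman]
  exact inner_koopman_neg_eq_zero hx hy n

/-- The normalized sums act isometrically on the martingale differences. -/
lemma inner_normSum {x y : Lp ℝ 2 S.μ} (hx : x ∈ S.martingaleDiff) (hy : y ∈ S.martingaleDiff)
    {n : ℕ} (hn : n ≠ 0) : inner ℝ (S.normSum n x) (S.normSum n y) = inner ℝ x y := by
  have hn' : (0 : ℝ) < n := by exact_mod_cast Nat.pos_of_ne_zero hn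
  rw [normSum_apply, normSum_apply, inner_smul_left, inner_smul_right, sum_inner]
  simp_rw [inner_sum]
  have h : ∀ i ∈ Finset.Icc 1 n, ∑ j ∈ Finset.Icc 1 n,
      inner ℝ (S.koopman (i : ℤ) x) (S.koopman (j : ℤ) y) = inner ℝ x y := by
    intro i hi
    rw [Finset.sum_eq_single_of_mem i hi, inner_koopman]
    intro j _ hji
    exact inner_koopman_koopman_of_ne hx hy (by exact_mod_cast hji.symm)
  rw [Finset.sum_congr rfl h, Finset.sum_const, Nat.card_Icc, nsmul_eq_mul]
  have hs : √(n : ℝ) * √n = n := Real.mul_self_sqrt hn'.le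
  have hs0 : √(n : ℝ) ≠ 0 := by positivity
  simp only [add_tsub_cancel_right, RCLike.conj_to_real]
  field_simp
  rw [pow_two, hs]

lemma coeFn_normSum (n : ℕ) (x : Lp ℝ 2 S.μ) {X : Ω → ℝ} (hX : x =ᵐ[S.μ] X) :
    S.normSum n x =ᵐ[S.μ]
      fun ω => 1 / √(n : ℝ) * ∑ j ∈ Finset.Icc 1 n, X (S.iter (j : ℤ) ω) := by
  rw [normSum_apply]
  have h : ∀ᵐ ω ∂S.μ, ∀ j : ℕ, S.koopman (j : ℤ) x ω = X (S.iter (j : ℤ) ω) := by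
    refine ae_all_iff.2 fun j => ?_
    filter_upwards [S.coeFn_koopman (j : ℤ) x,
      (S.measurePreserving_iter (j : ℤ)).quasiMeasurePreserving.ae hX] with ω h1 h2
    rw [h1, Function.comp_apply, h2]
  filter_upwards [Lp.coeFn_smul (1 / √(n : ℝ)) (∑ j ∈ Finset.Icc 1 n, S.koopman (j : ℤ) x),
    coeFn_sum_Lp (Finset.Icc 1 n) (fun j => S.koopman (j : ℤ) x), h] with ω h1 h2 h3
  rw [h1, Pi.smul_apply, h2, smul_eq_mul]
  simp_rw [h3]

/-- The forward sum is a Birkhoff sum of `T⁻¹` started at `T ^ n ω`. The Birkhoff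
sums of `T⁻¹` are measurable with respect to `F₀`. -/
lemma sum_Icc_comp_iter (X : Ω → ℝ) (n : ℕ) (ω : Ω) :
    ∑ j ∈ Finset.Icc 1 n, X (S.iter (j : ℤ) ω)
      = birkhoffSum S.T.symm X n (S.iter (n : ℤ) ω) := by
  rw [birkhoffSum, ← Finset.sum_range_reflect, Finset.range_eq_Ico,
    Finset.sum_Ico_eq_sum_range, ← Finset.Ico_add_one_right_eq_Icc, Finset.sum_Ico_eq_sum_range]
  refine Finset.sum_congr (by simp) fun k hk => ?_
  have hk' : k < n := by simpa using hk
  rw [← iter_neg_natCast, ← Function.comp_apply (f := S.iter _), ← iter_add]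
  congr 2
  push_cast
  omega

/-- Central limit theorem for the martingale differences of one system. It is derived from the sums
of `X ∘ T⁻ʲ`, `0 ≤ j < n`, which have the same law: in them `X` is the last difference, and the
other summands are measurable with respect to `F₋₁`. -/
theorem tendsto_charFun_normSum {x : Lp ℝ 2 S.μ} (hx : x ∈ S.martingaleDiff) (t : ℝ) :
    Tendsto (fun n : ℕ => charFun (S.μ.map (S.normSum n x)) t) atTop
      (𝓝 (Complex.exp (-(t ^ 2 * ‖x‖ ^ 2) / 2 : ℝ))) := by
  obtain ⟨X, hXF, hxX⟩ := hx.1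
  have hXF : Measurable[S.F₀] X := hXF.measurable
  have hXm : Measurable X := hXF.mono S.F₀_le le_rfl
  have hX : MemLp X 2 S.μ := (Lp.memLp x).ae_eq hxX
  have hX0 : S.μ[X | S.filt (-1)] =ᵐ[S.μ] 0 := (condExp_congr_ae hxX.symm).trans hx.2
  have hv : ‖x‖ ^ 2 = ∫ ω, X ω ^ 2 ∂S.μ := by
    rw [← real_inner_self_eq_norm_sq, L2.inner_def]
    refine integral_congr_ae ?_
    filter_upwards [hxX] with ω hω
    simp [hω, pow_two]
  have hB : ∀ k, Measurable[S.F₀] (birkhoffSum S.T.symm X k) := fun k =>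
    @measurable_birkhoffSum Ω S.F₀ S.T.symm X S.measurable_symm_F₀ hXF k
  have hmart : ∀ (u : ℝ) (k : ℕ), ∫ ω, Complex.exp ((u * birkhoffSum S.T.symm X k (S.T.symm ω) : ℝ)
      * Complex.I) * (X ω : ℂ) ∂S.μ = 0 := by
    intro u k
    refine integral_exp_mul_eq_zero_of_condExp_eq_zero (m := S.filt (-1)) (S.filt_le (-1)) hX hX0
      (g := fun ω => u * birkhoffSum S.T.symm X k (S.T.symm ω)) ?_
    have h1 : Measurable[S.filt (-1)] (birkhoffSum S.T.symm X k ∘ S.iter (-1)) :=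
      (hB k).comp (comap_measurable _)
    rw [iter_neg_one] at h1
    exact h1.const_mul u
  rw [hv]
  refine (tendsto_integral_exp_birkhoffSum S.ergodic.symm hXm hX hmart t).congr fun n => ?_
  rw [charFun_apply_real, integral_map (Lp.aestronglyMeasurable _).aemeasurable (by fun_prop),
    ← integral_comp_of_measurePreserving (S.measurePreserving_iter n)
      (integrable_exp_mul_I (((hB n).mono S.F₀_le le_rfl).const_mul (t / √n))).aestronglyMeasurable]
  refine integral_congr_ae ?_
  filter_upwards [coeFn_normSum n x hxX] with ω hω
  rw [hω, sum_Icc_comp_iter]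
  push_cast
  ring_nf

/-- Joint central limit theorem for finitely many pairwise orthogonal martingale differences. -/
theorem tendstoInDistribution_normSum {ι : Type*} [Fintype ι] {e : ι → Lp ℝ 2 S.μ}
    (he : ∀ a, e a ∈ S.martingaleDiff) (horth : ∀ a b, a ≠ b → inner ℝ (e a) (e b) = 0)
    {Ω' : Type*} [MeasurableSpace Ω'] {P : Measure Ω'} [IsProbabilityMeasure P] {N : ι → Ω' → ℝ}
    (hN : ∀ a, HasLaw (N a) (gaussianReal 0 1) P) (hind : iIndepFun N P) :
    TendstoInDistribution (fun (n : ℕ) ω => WithLp.toLp 2 fun a => S.normSum n (e a) ω) atTop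
      (fun ω => WithLp.toLp 2 fun a => ‖e a‖ * N a ω) (fun _ => S.μ) P where
  forall_aemeasurable n := by
    have : ∀ a, AEMeasurable (S.normSum n (e a)) S.μ :=
      fun a => (Lp.aestronglyMeasurable _).aemeasurable
    fun_prop
  aemeasurable_limit := by
    have := fun a => (hN a).aemeasurable
    fun_prop
  tendsto := by
    have hm : ∀ n a, AEMeasurable (S.normSum n (e a)) S.μ :=
      fun n a => (Lp.aestronglyMeasurable _).aemeasurable
    refine ProbabilityMeasure.tendsto_of_tendsto_charFun fun θ => ?_
    simp only [ProbabilityMeasure.coe_mk]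
    rw [charFun_map_toLp_gaussian hN hind]
    have hnorm : ∑ a, θ a ^ 2 * ‖e a‖ ^ 2 = 1 ^ 2 * ‖∑ a, θ a • e a‖ ^ 2 := by
      rw [one_pow, one_mul, norm_sq_sum_smul horth]
    rw [hnorm]
    refine (tendsto_charFun_normSum (Submodule.sum_mem _ fun a _ =>
      Submodule.smul_mem _ (θ a) (he a)) 1).congr fun n => ?_
    rw [charFun_apply_real, charFun_apply,
      integral_map (Lp.aestronglyMeasurable _).aemeasurable (by fun_prop),
      integral_map (by have := hm n; fun_prop) (by fun_prop)]
    refine integral_congr_ae ?_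
    simp_rw [map_sum, map_smul]
    have h : ∀ᵐ ω ∂S.μ, ∀ a, (θ a • S.normSum n (e a) : Lp ℝ 2 S.μ) ω
        = θ a * S.normSum n (e a) ω := by
      refine ae_all_iff.2 fun a => ?_
      filter_upwards [Lp.coeFn_smul (θ a) (S.normSum n (e a))] with ω hω
      rw [hω, Pi.smul_apply, smul_eq_mul]
    filter_upwards [coeFn_sum_Lp Finset.univ fun a => θ a • S.normSum n (e a), h] with ω h1 h2
    rw [h1]
    simp [PiLp.inner_apply, h2]

end FilteredSystem

/-! ### Tensor products of square integrable functions -/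

section Tensor

variable {α β : Type*} [MeasurableSpace α] [MeasurableSpace β] {μ : Measure α} {ν : Measure β}

lemma ae_eq_comp_fst {x X : α → ℝ} (hx : x =ᵐ[μ] X) :
    ∀ᵐ ω ∂(μ.prod ν), x ω.1 = X ω.1 :=
  Measure.quasiMeasurePreserving_fst.ae hx

lemma ae_eq_comp_snd {y Y : β → ℝ} (hy : y =ᵐ[ν] Y) :
    ∀ᵐ ω ∂(μ.prod ν), y ω.2 = Y ω.2 :=
  Measure.quasiMeasurePreserving_snd.ae hy

lemma memLp_prod_mul {x : α → ℝ} {y : β → ℝ} (hx : MemLp x 2 μ) (hy : MemLp y 2 ν) :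
    MemLp (fun ω : α × β => x ω.1 * y ω.2) 2 (μ.prod ν) := by
  have hm : AEStronglyMeasurable (fun ω : α × β => x ω.1 * y ω.2) (μ.prod ν) :=
    hx.1.comp_fst.mul hy.1.comp_snd
  rw [memLp_two_iff_integrable_sq hm]
  simp_rw [mul_pow]
  exact hx.integrable_sq.mul_prod hy.integrable_sq

/-- The tensor product `(x ⊗ y) (ω₁, ω₂) = x ω₁ * y ω₂` as a bilinear map on `L²` spaces. -/
noncomputable def tens : Lp ℝ 2 μ →ₗ[ℝ] Lp ℝ 2 ν →ₗ[ℝ] Lp ℝ 2 (μ.prod ν) :=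
  LinearMap.mk₂ ℝ (fun x y => (memLp_prod_mul (Lp.memLp x) (Lp.memLp y)).toLp)
    (by
      intro x x' y
      rw [← MemLp.toLp_add]
      refine MemLp.toLp_congr _ _ ?_
      filter_upwards [ae_eq_comp_fst (ν := ν) (Lp.coeFn_add x x')] with ω h
      rw [h, Pi.add_apply, add_mul]
      rfl)
    (by
      intro c x y
      rw [← MemLp.toLp_const_smul]
      refine MemLp.toLp_congr _ _ ?_
      filter_upwards [ae_eq_comp_fst (ν := ν) (Lp.coeFn_smul c x)] with ω h
      simp [h, mul_assoc])
    (by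
      intro x y y'
      rw [← MemLp.toLp_add]
      refine MemLp.toLp_congr _ _ ?_
      filter_upwards [ae_eq_comp_snd (μ := μ) (Lp.coeFn_add y y')] with ω h
      rw [h, Pi.add_apply, mul_add]
      rfl)
    (by
      intro c x y
      rw [← MemLp.toLp_const_smul]
      refine MemLp.toLp_congr _ _ ?_
      filter_upwards [ae_eq_comp_snd (μ := μ) (Lp.coeFn_smul c y)] with ω h
      simp [h, mul_left_comm])

lemma coeFn_tens (x : Lp ℝ 2 μ) (y : Lp ℝ 2 ν) {X : α → ℝ} {Y : β → ℝ} (hx : x =ᵐ[μ] X)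
    (hy : y =ᵐ[ν] Y) : tens x y =ᵐ[μ.prod ν] fun ω => X ω.1 * Y ω.2 := by
  filter_upwards [(memLp_prod_mul (Lp.memLp x) (Lp.memLp y)).coeFn_toLp,
    ae_eq_comp_fst (ν := ν) hx, ae_eq_comp_snd (μ := μ) hy] with ω h1 h2 h3
  rw [← h2, ← h3]
  exact h1

lemma sum_tens {ι : Type*} (s : Finset ι) (x : ι → Lp ℝ 2 μ) (y : Lp ℝ 2 ν) :
    tens (∑ i ∈ s, x i) y = ∑ i ∈ s, tens (x i) y := by
  rw [map_sum, LinearMap.sum_apply]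

variable [IsProbabilityMeasure μ] [IsProbabilityMeasure ν]

lemma inner_tens (x x' : Lp ℝ 2 μ) (y y' : Lp ℝ 2 ν) :
    inner ℝ (tens x y) (tens x' y') = inner ℝ x x' * inner ℝ y y' := by
  simp only [L2.inner_def]
  rw [← integral_prod_mul]
  refine integral_congr_ae ?_
  filter_upwards [coeFn_tens x y (ae_eq_refl _) (ae_eq_refl _),
    coeFn_tens x' y' (ae_eq_refl _) (ae_eq_refl _)] with ω h1 h2
  rw [h1, h2]
  simp
  ring

lemma norm_tens (x : Lp ℝ 2 μ) (y : Lp ℝ 2 ν) : ‖tens x y‖ = ‖x‖ * ‖y‖ := by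
  rw [← sq_eq_sq₀ (norm_nonneg _) (by positivity), mul_pow, ← real_inner_self_eq_norm_sq,
    ← real_inner_self_eq_norm_sq, ← real_inner_self_eq_norm_sq, inner_tens]

end Tensor

/-! ### The product action on triple tensors -/

section Product

variable {Ω₁ Ω₂ Ω₃ : Type*} [MeasurableSpace Ω₁] [MeasurableSpace Ω₂] [MeasurableSpace Ω₃]
  (S₁ : FilteredSystem Ω₁) (S₂ : FilteredSystem Ω₂) (S₃ : FilteredSystem Ω₃)

lemma measurePreserving_prodAction (i j k : ℤ) :
    MeasurePreserving (prodAction S₁ S₂ S₃ i j k) (S₁.μ.prod (S₂.μ.prod S₃.μ))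
      (S₁.μ.prod (S₂.μ.prod S₃.μ)) :=
  (S₁.measurePreserving_iter i).prod ((S₂.measurePreserving_iter j).prod
    (S₃.measurePreserving_iter k))

/-- The Koopman operator of `T_{i,j,k}` on `L²` of the product space. -/
noncomputable def prodKoopman (i j k : ℤ) :
    Lp ℝ 2 (S₁.μ.prod (S₂.μ.prod S₃.μ)) →L[ℝ] Lp ℝ 2 (S₁.μ.prod (S₂.μ.prod S₃.μ)) :=
  (Lp.compMeasurePreservingₗᵢ ℝ _
    (measurePreserving_prodAction S₁ S₂ S₃ i j k)).toContinuousLinearMap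

lemma coeFn_prodKoopman (i j k : ℤ) (f : Lp ℝ 2 (S₁.μ.prod (S₂.μ.prod S₃.μ))) :
    prodKoopman S₁ S₂ S₃ i j k f =ᵐ[S₁.μ.prod (S₂.μ.prod S₃.μ)]
      f ∘ prodAction S₁ S₂ S₃ i j k :=
  Lp.coeFn_compMeasurePreserving f (measurePreserving_prodAction S₁ S₂ S₃ i j k)

/-- The normalized rectangular sums as operators on `L²` of the product space. -/
noncomputable def prodNormSum (p : ℕ × ℕ × ℕ) :
    Lp ℝ 2 (S₁.μ.prod (S₂.μ.prod S₃.μ)) →L[ℝ] Lp ℝ 2 (S₁.μ.prod (S₂.μ.prod S₃.μ)) :=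
  (1 / √((p.1 : ℝ) * p.2.1 * p.2.2)) •
    ∑ i ∈ Finset.Icc 1 p.1, ∑ j ∈ Finset.Icc 1 p.2.1, ∑ k ∈ Finset.Icc 1 p.2.2,
      prodKoopman S₁ S₂ S₃ i j k

lemma prodNormSum_apply (p : ℕ × ℕ × ℕ) (f : Lp ℝ 2 (S₁.μ.prod (S₂.μ.prod S₃.μ))) :
    prodNormSum S₁ S₂ S₃ p f = (1 / √((p.1 : ℝ) * p.2.1 * p.2.2)) •
      ∑ i ∈ Finset.Icc 1 p.1, ∑ j ∈ Finset.Icc 1 p.2.1, ∑ k ∈ Finset.Icc 1 p.2.2,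
        prodKoopman S₁ S₂ S₃ i j k f := by
  simp [prodNormSum]

lemma coeFn_prodNormSum (p : ℕ × ℕ × ℕ) {f : Lp ℝ 2 (S₁.μ.prod (S₂.μ.prod S₃.μ))}
    {F : Ω₁ × Ω₂ × Ω₃ → ℝ} (hf : f =ᵐ[S₁.μ.prod (S₂.μ.prod S₃.μ)] F) :
    prodNormSum S₁ S₂ S₃ p f =ᵐ[S₁.μ.prod (S₂.μ.prod S₃.μ)]
      normalizedSum (prodAction S₁ S₂ S₃) F p := by
  rw [prodNormSum_apply]
  simp_rw [← Finset.sum_product']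
  have h : ∀ᵐ ω ∂(S₁.μ.prod (S₂.μ.prod S₃.μ)), ∀ q : ℕ × ℕ × ℕ,
      prodKoopman S₁ S₂ S₃ q.1 q.2.1 q.2.2 f ω
        = F (prodAction S₁ S₂ S₃ q.1 q.2.1 q.2.2 ω) := by
    refine ae_all_iff.2 fun q => ?_
    filter_upwards [coeFn_prodKoopman S₁ S₂ S₃ q.1 q.2.1 q.2.2 f,
      (measurePreserving_prodAction S₁ S₂ S₃ q.1 q.2.1 q.2.2).quasiMeasurePreserving.ae hf]
      with ω h1 h2
    rw [h1, Function.comp_apply, h2]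
  filter_upwards [Lp.coeFn_smul (1 / √((p.1 : ℝ) * p.2.1 * p.2.2))
      (∑ q ∈ Finset.Icc 1 p.1 ×ˢ Finset.Icc 1 p.2.1 ×ˢ Finset.Icc 1 p.2.2,
        prodKoopman S₁ S₂ S₃ q.1 q.2.1 q.2.2 f),
    coeFn_sum_Lp (Finset.Icc 1 p.1 ×ˢ Finset.Icc 1 p.2.1 ×ˢ Finset.Icc 1 p.2.2)
      (fun q => prodKoopman S₁ S₂ S₃ q.1 q.2.1 q.2.2 f), h] with ω h1 h2 h3
  rw [h1, Pi.smul_apply, h2, smul_eq_mul, normalizedSum]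
  simp_rw [h3, ← Finset.sum_product']

lemma prodKoopman_tens (i j k : ℤ) (x : Lp ℝ 2 S₁.μ) (y : Lp ℝ 2 S₂.μ) (z : Lp ℝ 2 S₃.μ) :
    prodKoopman S₁ S₂ S₃ i j k (tens x (tens y z))
      = tens (S₁.koopman i x) (tens (S₂.koopman j y) (S₃.koopman k z)) := by
  refine Lp.ext ?_
  have h1 := coeFn_tens (S₁.koopman i x) _ (S₁.coeFn_koopman i x)
    (coeFn_tens (S₂.koopman j y) _ (S₂.coeFn_koopman j y) (S₃.coeFn_koopman k z))
  have h2 := coeFn_tens x (tens y z) (ae_eq_refl _)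
    (coeFn_tens y z (ae_eq_refl _) (ae_eq_refl _))
  filter_upwards [h1, (measurePreserving_prodAction S₁ S₂ S₃ i j k).quasiMeasurePreserving.ae h2,
    coeFn_prodKoopman S₁ S₂ S₃ i j k (tens x (tens y z))] with ω h1 h2 h3
  rw [h1, h3, Function.comp_apply, h2]
  rfl

/-- The normalized sum of a triple tensor is the tensor of the normalized sums. -/
lemma prodNormSum_tens (p : ℕ × ℕ × ℕ) (x : Lp ℝ 2 S₁.μ) (y : Lp ℝ 2 S₂.μ) (z : Lp ℝ 2 S₃.μ) :
    prodNormSum S₁ S₂ S₃ p (tens x (tens y z))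
      = tens (S₁.normSum p.1 x) (tens (S₂.normSum p.2.1 y) (S₃.normSum p.2.2 z)) := by
  rw [prodNormSum_apply, FilteredSystem.normSum_apply, FilteredSystem.normSum_apply,
    FilteredSystem.normSum_apply]
  simp only [map_smul, LinearMap.smul_apply, smul_smul]
  congr 1
  · rw [Real.sqrt_mul (by positivity), Real.sqrt_mul (by positivity)]
    ring
  · rw [sum_tens]
    refine Finset.sum_congr rfl fun i _ => ?_
    rw [sum_tens, map_sum]
    refine Finset.sum_congr rfl fun j _ => ?_
    rw [map_sum, map_sum]
    exact Finset.sum_congr rfl fun k _ => prodKoopman_tens S₁ S₂ S₃ i j k x y z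

lemma minAtTop_le : minAtTop ≤ atTop ×ˢ (atTop ×ˢ atTop) := by
  have h : Tendsto (fun p : ℕ × ℕ × ℕ => min p.1 (min p.2.1 p.2.2)) minAtTop atTop := tendsto_comap
  have h1 : Tendsto (fun p : ℕ × ℕ × ℕ => p.1) minAtTop atTop :=
    tendsto_atTop_mono (fun p => min_le_left _ _) h
  have h2 : Tendsto (fun p : ℕ × ℕ × ℕ => p.2.1) minAtTop atTop :=
    tendsto_atTop_mono (fun p => (min_le_right _ _).trans (min_le_left _ _)) h
  have h3 : Tendsto (fun p : ℕ × ℕ × ℕ => p.2.2) minAtTop atTop :=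
    tendsto_atTop_mono (fun p => (min_le_right _ _).trans (min_le_right _ _)) h
  exact h1.prodMk (h2.prodMk h3)

end Product

/-! ### Convergence in distribution -/

section Distribution

/-- On a product space, functions of different coordinates converge jointly as soon as each of them
converges, along independent indices. -/
lemma tendstoInDistribution_prodMk {E F : Type*} [TopologicalSpace E] [TopologicalSpace F]
    [MeasurableSpace E] [MeasurableSpace F] [BorelSpace E] [BorelSpace F]
    [SecondCountableTopology E] [SecondCountableTopology F]
    [TopologicalSpace.PseudoMetrizableSpace E] [TopologicalSpace.PseudoMetrizableSpace F]
    {α β Ω' ι κ : Type*} [MeasurableSpace α] [MeasurableSpace β] [MeasurableSpace Ω']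
    {μ : Measure α} {ν : Measure β} {P : Measure Ω'}
    [IsProbabilityMeasure μ] [IsProbabilityMeasure ν] [IsProbabilityMeasure P]
    {X : ι → α → E} {Y : κ → β → F} {X' : Ω' → E} {Y' : Ω' → F} {l : Filter ι} {l' : Filter κ}
    (hXm : ∀ i, Measurable (X i)) (hYm : ∀ i, Measurable (Y i))
    (hX : TendstoInDistribution X l X' (fun _ => μ) P)
    (hY : TendstoInDistribution Y l' Y' (fun _ => ν) P) (hind : IndepFun X' Y' P) :
    TendstoInDistribution (fun (p : ι × κ) (ω : α × β) => (X p.1 ω.1, Y p.2 ω.2)) (l ×ˢ l')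
      (fun ω => (X' ω, Y' ω)) (fun _ => μ.prod ν) P where
  forall_aemeasurable p :=
    (((hXm p.1).comp measurable_fst).prodMk ((hYm p.2).comp measurable_snd)).aemeasurable
  aemeasurable_limit := hX.aemeasurable_limit.prodMk hY.aemeasurable_limit
  tendsto := by
    have h1 := hX.tendsto.comp (tendsto_fst (f := l) (g := l'))
    have h2 := hY.tendsto.comp (tendsto_snd (f := l) (g := l'))
    have h3 := (ProbabilityMeasure.continuous_prod.tendsto _).comp (h1.prodMk_nhds h2)
    have h4 := (indepFun_iff_map_prod_eq_prod_map_map hX.aemeasurable_limit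
      hY.aemeasurable_limit).1 hind
    refine (h3.congr fun p => ?_).trans (le_of_eq ?_)
    · refine Subtype.ext ?_
      exact Measure.map_prod_map _ _ (hXm p.1) (hYm p.2)
    · congr 1
      exact Subtype.ext h4.symm

lemma integrable_comp_of_bounded_lipschitz {α : Type*} [MeasurableSpace α] {ρ : Measure α}
    [IsProbabilityMeasure ρ] {F : ℝ → ℝ} {C : ℝ} (hC : ∀ x y, dist (F x) (F y) ≤ C) {L : NNReal}
    (hL : LipschitzWith L F) (x : Lp ℝ 2 ρ) : Integrable (fun ω => F (x ω)) ρ := by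
  refine Integrable.of_bound (hL.continuous.comp_aestronglyMeasurable
    (Lp.aestronglyMeasurable x)) (|F 0| + C) (ae_of_all _ fun ω => ?_)
  have h1 := hC (x ω) 0
  rw [Real.dist_eq] at h1
  have h2 := abs_sub_abs_le_abs_sub (F (x ω)) (F 0)
  rw [Real.norm_eq_abs]
  linarith

lemma abs_integral_map_sub_le {α : Type*} [MeasurableSpace α] {ρ : Measure α}
    [IsProbabilityMeasure ρ] {F : ℝ → ℝ} {C : ℝ} (hC : ∀ x y, dist (F x) (F y) ≤ C) {L : NNReal}
    (hL : LipschitzWith L F) (x y : Lp ℝ 2 ρ) :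
    |∫ ω, F ω ∂(ρ.map x) - ∫ ω, F ω ∂(ρ.map y)| ≤ L * ‖x - y‖ := by
  have hx := integrable_comp_of_bounded_lipschitz hC hL x
  have hy := integrable_comp_of_bounded_lipschitz hC hL y
  rw [integral_map (Lp.aestronglyMeasurable x).aemeasurable
      hL.continuous.aestronglyMeasurable,
    integral_map (Lp.aestronglyMeasurable y).aemeasurable
      hL.continuous.aestronglyMeasurable, ← integral_sub hx hy]
  have hi : Integrable (x - y : Lp ℝ 2 ρ) ρ := (Lp.memLp _).integrable (by norm_num)
  calc |∫ ω, (F (x ω) - F (y ω)) ∂ρ| ≤ ∫ ω, |F (x ω) - F (y ω)| ∂ρ :=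
        abs_integral_le_integral_abs
    _ ≤ ∫ ω, L * |(x - y : Lp ℝ 2 ρ) ω| ∂ρ := by
        refine integral_mono_ae (hx.sub hy).abs (hi.abs.const_mul _) ?_
        filter_upwards [Lp.coeFn_sub x y] with ω hω
        rw [hω, Pi.sub_apply, ← Real.dist_eq, ← Real.dist_eq]
        exact hL.dist_le_mul _ _
    _ ≤ L * ‖x - y‖ := by
        rw [integral_const_mul]
        gcongr
        exact integral_abs_le_norm_Lp _

/-- Convergence in distribution passes to uniform `L²` limits, since integrals of bounded
Lipschitz functions detect it. -/
lemma tendstoInDistribution_of_approx {Ω Ω' ι : Type*} [MeasurableSpace Ω] [MeasurableSpace Ω']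
    {μ : Measure Ω} {P : Measure Ω'} [IsProbabilityMeasure μ] [IsProbabilityMeasure P]
    {l : Filter ι} [l.IsCountablyGenerated] (Y : ι → Lp ℝ 2 μ) (Z : Lp ℝ 2 P)
    (h : ∀ ε > 0, ∃ (X : ι → Lp ℝ 2 μ) (Z' : Lp ℝ 2 P),
      TendstoInDistribution (fun i => (X i : Ω → ℝ)) l Z' (fun _ => μ) P ∧
        (∀ᶠ i in l, ‖Y i - X i‖ ≤ ε) ∧ ‖Z' - Z‖ ≤ ε) :
    TendstoInDistribution (fun i => (Y i : Ω → ℝ)) l Z (fun _ => μ) P where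
  forall_aemeasurable i := (Lp.aestronglyMeasurable _).aemeasurable
  aemeasurable_limit := (Lp.aestronglyMeasurable _).aemeasurable
  tendsto := by
    refine tendsto_iff_forall_lipschitz_integral_tendsto.2 ?_
    rintro F ⟨C, hC⟩ ⟨L, hL⟩
    simp only [ProbabilityMeasure.coe_mk]
    rw [Metric.tendsto_nhds]
    intro η hη
    obtain ⟨X, Z', hXZ, hXY, hZ⟩ := h (η / (3 * (L + 1))) (by positivity)
    have hconv := tendsto_iff_forall_lipschitz_integral_tendsto.1 hXZ.tendsto F ⟨C, hC⟩ ⟨L, hL⟩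
    simp only [ProbabilityMeasure.coe_mk] at hconv
    filter_upwards [hXY, Metric.tendsto_nhds.1 hconv (η / 3) (by positivity)] with i h1 h2
    have hb : (L : ℝ) * (η / (3 * (L + 1))) ≤ η / 3 := by
      rw [mul_div_assoc', div_le_div_iff₀ (by positivity) (by positivity)]
      nlinarith [L.coe_nonneg]
    have h3 := (abs_integral_map_sub_le hC hL (Y i) (X i)).trans
      ((mul_le_mul_of_nonneg_left h1 L.coe_nonneg).trans hb)
    have h4 := (abs_integral_map_sub_le hC hL Z' Z).trans
      ((mul_le_mul_of_nonneg_left hZ L.coe_nonneg).trans hb)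
    rw [Real.dist_eq] at h2 ⊢
    rw [abs_lt] at h2 ⊢
    rw [abs_le] at h3 h4
    constructor <;> linarith [h2.1, h2.2, h3.1, h3.2, h4.1, h4.2]

end Distribution

/-! ### The limiting Gaussian series -/

section Gaussian

variable {Ω' : Type*} [MeasurableSpace Ω'] {P : Measure Ω'}
  {N : Fin 3 → ℕ → Ω' → ℝ}

namespace IsIndepGaussianSequences

lemma measurable_seq (hN : IsIndepGaussianSequences P N) (t : Fin 3) :
    Measurable fun ω a => N t a ω :=
  measurable_pi_lambda _ fun a => hN.measurable t a

lemma indepFun_prodMk (hN : IsIndepGaussianSequences P N) :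
    IndepFun (fun ω a => N 0 a ω) (fun ω => ((fun a => N 1 a ω), fun a => N 2 a ω)) P :=
  (hN.iIndepFun_seq.indepFun_prodMk (fun t => hN.measurable_seq t) 1 2 0
    (by decide) (by decide)).symm

lemma indepFun_one_two (hN : IsIndepGaussianSequences P N) :
    IndepFun (fun ω a => N 1 a ω) (fun ω a => N 2 a ω) P :=
  hN.iIndepFun_seq.indepFun (by decide)

/-- The three sequences together transport `P` to a product measure. -/
lemma measurePreserving [IsProbabilityMeasure P] (hN : IsIndepGaussianSequences P N) :
    MeasurePreserving
      (fun ω => ((fun a => N 0 a ω), ((fun a => N 1 a ω), fun a => N 2 a ω))) P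
      ((P.map fun ω a => N 0 a ω).prod
        ((P.map fun ω a => N 1 a ω).prod (P.map fun ω a => N 2 a ω))) := by
  refine ⟨(hN.measurable_seq 0).prodMk ((hN.measurable_seq 1).prodMk (hN.measurable_seq 2)), ?_⟩
  rw [(indepFun_iff_map_prod_eq_prod_map_map (hN.measurable_seq 0).aemeasurable
      ((hN.measurable_seq 1).prodMk (hN.measurable_seq 2)).aemeasurable).1 hN.indepFun_prodMk,
    (indepFun_iff_map_prod_eq_prod_map_map (hN.measurable_seq 1).aemeasurable
      (hN.measurable_seq 2).aemeasurable).1 hN.indepFun_one_two]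

lemma memLp (hN : IsIndepGaussianSequences P N) (t : Fin 3) (a : ℕ) : MemLp (N t a) 2 P := by
  have h : MemLp id 2 (P.map (N t a)) := by
    rw [(hN.hasLaw t a).map_eq]
    exact memLp_id_gaussianReal 2
  exact (memLp_map_measure_iff aestronglyMeasurable_id
    (hN.measurable t a).aemeasurable).1 h

lemma integral_eq_zero (hN : IsIndepGaussianSequences P N) (t : Fin 3) (a : ℕ) :
    ∫ ω, N t a ω ∂P = 0 := by
  rw [(hN.hasLaw t a).integral_eq, integral_id_gaussianReal]

lemma integral_mul [IsProbabilityMeasure P] (hN : IsIndepGaussianSequences P N) (t : Fin 3)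
    (a b : ℕ) : ∫ ω, N t a ω * N t b ω ∂P = if a = b then 1 else 0 := by
  split_ifs with h
  · subst h
    have h1 := variance_eq_sub (hN.memLp t a)
    rw [hN.integral_eq_zero t a, (hN.hasLaw t a).variance_eq, variance_id_gaussianReal] at h1
    simpa [pow_two] using h1.symm
  · have h1 := (hN.iIndepFun_each t).indepFun h
    have h2 := h1.integral_mul_eq_mul_integral (hN.memLp t a).1 (hN.memLp t b).1
    rw [hN.integral_eq_zero t a, zero_mul] at h2
    exact h2

end IsIndepGaussianSequences

lemma memLp_coord (hN : IsIndepGaussianSequences P N) (t : Fin 3) (a : ℕ) :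
    MemLp (fun x : ℕ → ℝ => x a) 2 (P.map fun ω a => N t a ω) :=
  (memLp_map_measure_iff (measurable_pi_apply a).aestronglyMeasurable
    (hN.measurable_seq t).aemeasurable).2 (hN.memLp t a)

/-- The products `N⁽¹⁾_a N⁽²⁾_b N⁽³⁾_c` are orthonormal in `L²`. -/
lemma exists_orthonormal_gaussianTriple [IsProbabilityMeasure P]
    (hN : IsIndepGaussianSequences P N) :
    ∃ G : ℕ × ℕ × ℕ → Lp ℝ 2 P, Orthonormal ℝ G ∧
      ∀ p, G p =ᵐ[P] fun ω => N 0 p.1 ω * (N 1 p.2.1 ω * N 2 p.2.2 ω) := by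
  have hp : ∀ t, IsProbabilityMeasure (P.map fun ω a => N t a ω) := fun t =>
    Measure.isProbabilityMeasure_map (hN.measurable_seq t).aemeasurable
  have h0 := hp 0
  have h1 := hp 1
  have h2 := hp 2
  have hinner : ∀ t a b, inner ℝ (memLp_coord hN t a).toLp (memLp_coord hN t b).toLp
      = if a = b then (1 : ℝ) else 0 := by
    intro t a b
    rw [← hN.integral_mul t a b, L2.inner_def]
    have h3 : ∫ x, x a * x b ∂(P.map fun ω a => N t a ω) = ∫ ω, N t a ω * N t b ω ∂P :=
      integral_map (hN.measurable_seq t).aemeasurable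
        ((measurable_pi_apply a).mul (measurable_pi_apply b)).aestronglyMeasurable
    rw [← h3]
    refine integral_congr_ae ?_
    filter_upwards [(memLp_coord hN t a).coeFn_toLp, (memLp_coord hN t b).coeFn_toLp] with x ha hb
    rw [ha, hb]
    simp [mul_comm]
  refine ⟨fun p => Lp.compMeasurePreservingₗᵢ ℝ _ hN.measurePreserving
    (tens (memLp_coord hN 0 p.1).toLp
      (tens (memLp_coord hN 1 p.2.1).toLp (memLp_coord hN 2 p.2.2).toLp)), ?_, ?_⟩
  · rw [orthonormal_iff_ite]
    intro p q
    rw [LinearIsometry.inner_map_map, inner_tens, inner_tens, hinner, hinner, hinner]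
    simp only [Prod.ext_iff]
    split_ifs <;> simp_all
  · intro p
    filter_upwards [Lp.coeFn_compMeasurePreserving (tens (memLp_coord hN 0 p.1).toLp
      (tens (memLp_coord hN 1 p.2.1).toLp (memLp_coord hN 2 p.2.2).toLp)) hN.measurePreserving,
      hN.measurePreserving.quasiMeasurePreserving.ae (coeFn_tens _ _
        (memLp_coord hN 0 p.1).coeFn_toLp (coeFn_tens _ _ (memLp_coord hN 1 p.2.1).coeFn_toLp
          (memLp_coord hN 2 p.2.2).coeFn_toLp))] with ω h3 h4
    refine h3.trans ?_
    rw [Function.comp_apply, h4]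

end Gaussian

/-! ### The limit theorem for series of tensors -/

/-- A sequence of pairwise orthogonal martingale differences of norm at most one. Allowing some of
them to vanish makes it possible to index by `ℕ` also when the space of martingale differences is
finite dimensional. -/
structure IsOrthogonalDiff {Ω : Type*} [MeasurableSpace Ω] (S : FilteredSystem Ω)
    (e : ℕ → Lp ℝ 2 S.μ) : Prop where
  mem : ∀ a, e a ∈ S.martingaleDiff
  inner_eq_zero : ∀ a b, a ≠ b → inner ℝ (e a) (e b) = 0
  norm_le_one : ∀ a, ‖e a‖ ≤ 1

namespace IsOrthogonalDiff

variable {Ω : Type*} [MeasurableSpace Ω] {S : FilteredSystem Ω} {e : ℕ → Lp ℝ 2 S.μ}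

lemma norm_normSum_le_one (he : IsOrthogonalDiff S e) {n : ℕ} (hn : n ≠ 0) (a : ℕ) :
    ‖S.normSum n (e a)‖ ≤ 1 := by
  refine le_trans (le_of_eq ?_) (he.norm_le_one a)
  rw [← sq_eq_sq₀ (norm_nonneg _) (norm_nonneg _), ← real_inner_self_eq_norm_sq,
    ← real_inner_self_eq_norm_sq, FilteredSystem.inner_normSum (he.mem a) (he.mem a) hn]

lemma inner_normSum_eq_zero (he : IsOrthogonalDiff S e) {n : ℕ} (hn : n ≠ 0) (a b : ℕ)
    (hab : a ≠ b) : inner ℝ (S.normSum n (e a)) (S.normSum n (e b)) = 0 := by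
  rw [FilteredSystem.inner_normSum (he.mem a) (he.mem b) hn, he.inner_eq_zero a b hab]

end IsOrthogonalDiff

instance : minAtTop.IsCountablyGenerated := by
  unfold minAtTop; infer_instance

lemma eventually_minAtTop_ne_zero :
    ∀ᶠ p : ℕ × ℕ × ℕ in minAtTop, p.1 ≠ 0 ∧ p.2.1 ≠ 0 ∧ p.2.2 ≠ 0 := by
  filter_upwards [tendsto_comap.eventually (eventually_gt_atTop 0)] with p hp
  simp only [lt_min_iff] at hp
  exact ⟨hp.1.ne', hp.2.1.ne', hp.2.2.ne'⟩

lemma inner_tens_eq_zero {α β γ : Type*} [MeasurableSpace α] [MeasurableSpace β]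
    [MeasurableSpace γ] {μ : Measure α} {ν : Measure β} {ρ : Measure γ} [IsProbabilityMeasure μ]
    [IsProbabilityMeasure ν] [IsProbabilityMeasure ρ] {x : ℕ → Lp ℝ 2 μ} {y : ℕ → Lp ℝ 2 ν}
    {z : ℕ → Lp ℝ 2 ρ} (hx : ∀ a b, a ≠ b → inner ℝ (x a) (x b) = 0)
    (hy : ∀ a b, a ≠ b → inner ℝ (y a) (y b) = 0) (hz : ∀ a b, a ≠ b → inner ℝ (z a) (z b) = 0)
    (p q : ℕ × ℕ × ℕ) (hpq : p ≠ q) :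
    inner ℝ (tens (x p.1) (tens (y p.2.1) (z p.2.2)))
      (tens (x q.1) (tens (y q.2.1) (z q.2.2))) = 0 := by
  rw [inner_tens, inner_tens]
  by_cases h1 : p.1 = q.1
  · by_cases h2 : p.2.1 = q.2.1
    · have h3 : p.2.2 ≠ q.2.2 := fun h3 => hpq (Prod.ext h1 (Prod.ext h2 h3))
      rw [hz _ _ h3, mul_zero, mul_zero]
    · rw [hy _ _ h2, zero_mul, mul_zero]
  · rw [hx _ _ h1, zero_mul]

section Limit

variable {Ω₁ Ω₂ Ω₃ : Type*} [MeasurableSpace Ω₁] [MeasurableSpace Ω₂] [MeasurableSpace Ω₃]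
  {S₁ : FilteredSystem Ω₁} {S₂ : FilteredSystem Ω₂} {S₃ : FilteredSystem Ω₃}
  {e₁ : ℕ → Lp ℝ 2 S₁.μ} {e₂ : ℕ → Lp ℝ 2 S₂.μ} {e₃ : ℕ → Lp ℝ 2 S₃.μ}
  {Ω' : Type*} [MeasurableSpace Ω'] {P : Measure Ω'} [IsProbabilityMeasure P]
  {N : Fin 3 → ℕ → Ω' → ℝ}

/-- The coordinate `a` of a vector of length `K`, extended by zero. -/
noncomputable def coordOrZero {K : ℕ} (a : ℕ) (x : EuclideanSpace ℝ (Fin K)) : ℝ :=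
  if h : a < K then x ⟨a, h⟩ else 0

lemma continuous_coordOrZero {K : ℕ} (a : ℕ) :
    Continuous (coordOrZero a : EuclideanSpace ℝ (Fin K) → ℝ) := by
  unfold coordOrZero
  split_ifs <;> fun_prop

lemma coordOrZero_toLp {K a : ℕ} (h : a < K) (v : ℕ → ℝ) :
    coordOrZero a (WithLp.toLp 2 fun i : Fin K => v i) = v a := by
  simp [coordOrZero, h]

lemma measurable_toLp_normSum {Ω : Type*} [MeasurableSpace Ω] (K : ℕ) (S : FilteredSystem Ω)
    (e : ℕ → Lp ℝ 2 S.μ) (n : ℕ) :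
    Measurable fun ω => (WithLp.toLp 2 fun a : Fin K => S.normSum n (e a) ω :
      EuclideanSpace ℝ (Fin K)) := by
  have : ∀ a : Fin K, Measurable (S.normSum n (e a)) :=
    fun a => (Lp.stronglyMeasurable _).measurable
  fun_prop

/-- Convergence of the vectors of normalized sums of the three systems, jointly. -/
lemma tendstoInDistribution_normSum_triple (h₁ : IsOrthogonalDiff S₁ e₁)
    (h₂ : IsOrthogonalDiff S₂ e₂) (h₃ : IsOrthogonalDiff S₃ e₃)
    (hN : IsIndepGaussianSequences P N) (K : ℕ) :
    TendstoInDistribution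
      (fun (p : ℕ × ℕ × ℕ) (ω : Ω₁ × Ω₂ × Ω₃) =>
        ((WithLp.toLp 2 fun a : Fin K => S₁.normSum p.1 (e₁ a) ω.1 : EuclideanSpace ℝ (Fin K)),
          ((WithLp.toLp 2 fun a : Fin K => S₂.normSum p.2.1 (e₂ a) ω.2.1 :
              EuclideanSpace ℝ (Fin K)),
            (WithLp.toLp 2 fun a : Fin K => S₃.normSum p.2.2 (e₃ a) ω.2.2 :
              EuclideanSpace ℝ (Fin K))))) minAtTop
      (fun ω => ((WithLp.toLp 2 fun a : Fin K => ‖e₁ a‖ * N 0 a ω : EuclideanSpace ℝ (Fin K)),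
        ((WithLp.toLp 2 fun a : Fin K => ‖e₂ a‖ * N 1 a ω : EuclideanSpace ℝ (Fin K)),
          (WithLp.toLp 2 fun a : Fin K => ‖e₃ a‖ * N 2 a ω : EuclideanSpace ℝ (Fin K)))))
      (fun _ => S₁.μ.prod (S₂.μ.prod S₃.μ)) P := by
  have hind : ∀ t, iIndepFun (fun a : Fin K => N t a) P := fun t =>
    (hN.iIndepFun_each t).precomp Fin.val_injective
  have c₁ := FilteredSystem.tendstoInDistribution_normSum (fun a : Fin K => h₁.mem a)
    (fun a b hab => h₁.inner_eq_zero a b (Fin.val_injective.ne hab))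
    (fun a => hN.hasLaw 0 a) (hind 0)
  have c₂ := FilteredSystem.tendstoInDistribution_normSum (fun a : Fin K => h₂.mem a)
    (fun a b hab => h₂.inner_eq_zero a b (Fin.val_injective.ne hab))
    (fun a => hN.hasLaw 1 a) (hind 1)
  have c₃ := FilteredSystem.tendstoInDistribution_normSum (fun a : Fin K => h₃.mem a)
    (fun a b hab => h₃.inner_eq_zero a b (Fin.val_injective.ne hab))
    (fun a => hN.hasLaw 2 a) (hind 2)
  have g : ∀ c : ℕ → ℝ, Measurable fun x : ℕ → ℝ =>
      (WithLp.toLp 2 fun a : Fin K => c a * x a : EuclideanSpace ℝ (Fin K)) := by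
    intro c
    fun_prop
  have c₂₃ := tendstoInDistribution_prodMk (measurable_toLp_normSum K S₂ e₂)
    (measurable_toLp_normSum K S₃ e₃) c₂ c₃
    (hN.indepFun_one_two.comp (g fun a => ‖e₂ a‖) (g fun a => ‖e₃ a‖))
  have c := tendstoInDistribution_prodMk (measurable_toLp_normSum K S₁ e₁)
    (fun p : ℕ × ℕ => ((measurable_toLp_normSum K S₂ e₂ p.1).comp measurable_fst).prodMk
      ((measurable_toLp_normSum K S₃ e₃ p.2).comp measurable_snd)) c₁ c₂₃
    (hN.indepFun_prodMk.comp (g fun a => ‖e₁ a‖)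
      (((g fun a => ‖e₂ a‖).comp measurable_fst).prodMk
        ((g fun a => ‖e₃ a‖).comp measurable_snd)))
  exact ⟨c.1, c.2, c.3.mono_left minAtTop_le⟩

/-- The limit theorem for an `L²` convergent series of tensors of martingale differences. For
finite sums it follows from the joint central limit theorem and the continuous mapping theorem;
the remainders are controlled because normalized sums are isometric on martingale differences. -/
theorem exists_tripleGaussianSum_of_hasSum (h₁ : IsOrthogonalDiff S₁ e₁)
    (h₂ : IsOrthogonalDiff S₂ e₂) (h₃ : IsOrthogonalDiff S₃ e₃) {lam : ℕ × ℕ × ℕ → ℝ}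
    (hlam : Summable fun p => lam p ^ 2)
    (hlam1 : ∀ p, lam p ≠ 0 → ‖e₁ p.1‖ = 1 ∧ ‖e₂ p.2.1‖ = 1 ∧ ‖e₃ p.2.2‖ = 1)
    {f : Ω₁ × Ω₂ × Ω₃ → ℝ} {F : Lp ℝ 2 (S₁.μ.prod (S₂.μ.prod S₃.μ))}
    (hF : F =ᵐ[S₁.μ.prod (S₂.μ.prod S₃.μ)] f)
    (hsum : HasSum (fun p => lam p • tens (e₁ p.1) (tens (e₂ p.2.1) (e₃ p.2.2))) F)
    (hN : IsIndepGaussianSequences P N) :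
    ∃ Z : Ω' → ℝ, IsTripleGaussianSum P N lam Z ∧
      TendstoInDistribution (normalizedSum (prodAction S₁ S₂ S₃) f) minAtTop Z
        (fun _ => prodMeasure S₁ S₂ S₃) P := by
  classical
  obtain ⟨G, hG, hGN⟩ := exists_orthonormal_gaussianTriple hN
  obtain ⟨Z, hZ⟩ := Orthonormal.summable_smul hG hlam
  refine ⟨Z, ⟨Lp.memLp Z, ?_⟩, ?_⟩
  · have h := (hZ.sub_const Z).norm
    rw [sub_self, norm_zero] at h
    have h := ENNReal.tendsto_ofReal h
    rw [ENNReal.ofReal_zero] at h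
    refine h.congr fun s => ?_
    rw [Lp.norm_def, ENNReal.ofReal_toReal (Lp.eLpNorm_ne_top _)]
    refine eLpNorm_congr_ae ?_
    have h2 : ∀ᵐ ω ∂P, ∀ p, (lam p • G p : Lp ℝ 2 P) ω
        = lam p * (N 0 p.1 ω * N 1 p.2.1 ω * N 2 p.2.2 ω) := by
      refine ae_all_iff.2 fun p => ?_
      filter_upwards [Lp.coeFn_smul (lam p) (G p), hGN p] with ω h3 h4
      rw [h3, Pi.smul_apply, h4, smul_eq_mul, mul_assoc (N 0 p.1 ω)]
    filter_upwards [Lp.coeFn_sub (∑ p ∈ s, lam p • G p) Z,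
      coeFn_sum_Lp s fun p => lam p • G p, h2] with ω h3 h4 h5
    rw [h3, Pi.sub_apply, h4]
    simp_rw [h5]
  suffices h : TendstoInDistribution
      (fun p => (prodNormSum S₁ S₂ S₃ p F : Ω₁ × Ω₂ × Ω₃ → ℝ)) minAtTop Z
      (fun _ => S₁.μ.prod (S₂.μ.prod S₃.μ)) P from
    h.congr (fun p => coeFn_prodNormSum S₁ S₂ S₃ p hF) (ae_eq_refl _)
  refine tendstoInDistribution_of_approx _ _ fun ε hε => ?_
  obtain ⟨s, hs⟩ := exists_finset_tsum_sub_le hlam (show 0 < ε ^ 2 by positivity)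
  refine ⟨fun p => ∑ q ∈ s, lam q • tens (S₁.normSum p.1 (e₁ q.1))
    (tens (S₂.normSum p.2.1 (e₂ q.2.1)) (S₃.normSum p.2.2 (e₃ q.2.2))), ∑ q ∈ s, lam q • G q,
    ?_, ?_, ?_⟩
  -- finite sums are continuous functions of the vectors of the first `K` normalized sums
  · obtain ⟨K, hK⟩ : ∃ K, ∀ q ∈ s, q.1 < K ∧ q.2.1 < K ∧ q.2.2 < K := by
      refine ⟨s.sup (fun q => q.1 + q.2.1 + q.2.2) + 1, fun q hq => ?_⟩
      have := Finset.le_sup (f := fun q : ℕ × ℕ × ℕ => q.1 + q.2.1 + q.2.2) hq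
      omega
    have hcont : Continuous fun x : EuclideanSpace ℝ (Fin K) ×
        (EuclideanSpace ℝ (Fin K) × EuclideanSpace ℝ (Fin K)) =>
        ∑ q ∈ s, lam q * (coordOrZero q.1 x.1 *
          (coordOrZero q.2.1 x.2.1 * coordOrZero q.2.2 x.2.2)) := by
      refine continuous_finsetSum _ fun q _ => continuous_const.mul ?_
      exact ((continuous_coordOrZero _).comp continuous_fst).mul
        (((continuous_coordOrZero _).comp (continuous_fst.comp continuous_snd)).mul
          ((continuous_coordOrZero _).comp (continuous_snd.comp continuous_snd)))
    refine ((tendstoInDistribution_normSum_triple h₁ h₂ h₃ hN K).continuous_comp hcont).congr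
      (fun p => ?_) ?_
    · have h : ∀ᵐ ω ∂(S₁.μ.prod (S₂.μ.prod S₃.μ)), ∀ q : ℕ × ℕ × ℕ,
          (lam q • tens (S₁.normSum p.1 (e₁ q.1)) (tens (S₂.normSum p.2.1 (e₂ q.2.1))
            (S₃.normSum p.2.2 (e₃ q.2.2))) : Lp ℝ 2 (S₁.μ.prod (S₂.μ.prod S₃.μ))) ω
          = lam q * (S₁.normSum p.1 (e₁ q.1) ω.1 * (S₂.normSum p.2.1 (e₂ q.2.1) ω.2.1 *
            S₃.normSum p.2.2 (e₃ q.2.2) ω.2.2)) := by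
        refine ae_all_iff.2 fun q => ?_
        filter_upwards [Lp.coeFn_smul (lam q) (tens (S₁.normSum p.1 (e₁ q.1))
            (tens (S₂.normSum p.2.1 (e₂ q.2.1)) (S₃.normSum p.2.2 (e₃ q.2.2)))),
          coeFn_tens (S₁.normSum p.1 (e₁ q.1)) _ (ae_eq_refl _)
            (coeFn_tens (S₂.normSum p.2.1 (e₂ q.2.1)) (S₃.normSum p.2.2 (e₃ q.2.2))
              (ae_eq_refl _) (ae_eq_refl _))] with ω h3 h4
        rw [h3, Pi.smul_apply, h4, smul_eq_mul]
      filter_upwards [coeFn_sum_Lp s fun q => lam q •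
        tens (S₁.normSum p.1 (e₁ q.1)) (tens (S₂.normSum p.2.1 (e₂ q.2.1))
            (S₃.normSum p.2.2 (e₃ q.2.2))), h] with ω h3 h4
      rw [h3]
      simp_rw [h4]
      refine Finset.sum_congr rfl fun q hq => ?_
      obtain ⟨k₁, k₂, k₃⟩ := hK q hq
      simp only
      rw [coordOrZero_toLp k₁ fun a => S₁.normSum p.1 (e₁ a) ω.1,
        coordOrZero_toLp k₂ fun a => S₂.normSum p.2.1 (e₂ a) ω.2.1,
        coordOrZero_toLp k₃ fun a => S₃.normSum p.2.2 (e₃ a) ω.2.2]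
    · have h : ∀ᵐ ω ∂P, ∀ q, (lam q • G q : Lp ℝ 2 P) ω
          = lam q * (N 0 q.1 ω * (N 1 q.2.1 ω * N 2 q.2.2 ω)) := by
        refine ae_all_iff.2 fun q => ?_
        filter_upwards [Lp.coeFn_smul (lam q) (G q), hGN q] with ω h3 h4
        rw [h3, Pi.smul_apply, h4, smul_eq_mul]
      filter_upwards [coeFn_sum_Lp s fun q => lam q • G q, h] with ω h3 h4
      rw [h3]
      simp_rw [h4]
      refine Finset.sum_congr rfl fun q hq => ?_
      obtain ⟨k₁, k₂, k₃⟩ := hK q hq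
      simp only
      rw [coordOrZero_toLp k₁ fun a => ‖e₁ a‖ * N 0 a ω,
        coordOrZero_toLp k₂ fun a => ‖e₂ a‖ * N 1 a ω,
        coordOrZero_toLp k₃ fun a => ‖e₃ a‖ * N 2 a ω]
      -- the joint limit has the factors `‖e a‖`, which are one wherever they matter
      by_cases h0 : lam q = 0
      · rw [h0, zero_mul, zero_mul]
      · obtain ⟨n₁, n₂, n₃⟩ := hlam1 q h0
        rw [n₁, n₂, n₃, one_mul, one_mul, one_mul]
  -- the normalized sums keep the tensors orthogonal, so the remainder is bounded as in `L²`
  · filter_upwards [eventually_minAtTop_ne_zero] with p hp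
    have hsum' := hsum.mapL (prodNormSum S₁ S₂ S₃ p)
    simp_rw [map_smul, prodNormSum_tens] at hsum'
    rw [← abs_of_nonneg hε.le, ← abs_of_nonneg (norm_nonneg _), ← sq_le_sq]
    refine (norm_sub_sum_sq_le (inner_tens_eq_zero (h₁.inner_normSum_eq_zero hp.1)
      (h₂.inner_normSum_eq_zero hp.2.1) (h₃.inner_normSum_eq_zero hp.2.2)) (fun q => ?_)
      hlam hsum' s).trans hs
    rw [norm_tens, norm_tens]
    exact mul_le_one₀ (h₁.norm_normSum_le_one hp.1 _) (by positivity)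
      (mul_le_one₀ (h₂.norm_normSum_le_one hp.2.1 _) (norm_nonneg _)
        (h₃.norm_normSum_le_one hp.2.2 _))
  · rw [norm_sub_rev, ← abs_of_nonneg hε.le, ← abs_of_nonneg (norm_nonneg _), ← sq_le_sq]
    exact (norm_sub_sum_sq_le (fun p q hpq => hG.2 hpq) (fun q => (hG.1 q).le) hlam
      hZ s).trans hs

end Limit

/-! ### Product σ-algebras -/

section SigmaAlgebra

variable {α β γ : Type*}

lemma setIntegral_eq_zero_of_isPiSystem {m mα : MeasurableSpace α} (hm : m ≤ mα) {μ : Measure α}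
    {r : α → ℝ} (hr : Integrable r μ) {C : Set (Set α)} (hC : m = MeasurableSpace.generateFrom C)
    (hpi : IsPiSystem C) (huniv : Set.univ ∈ C) (h : ∀ s ∈ C, ∫ ω in s, r ω ∂μ = 0) (s : Set α)
    (hs : MeasurableSet[m] s) : ∫ ω in s, r ω ∂μ = 0 := by
  induction s, hs using MeasurableSpace.induction_on_inter hC hpi with
  | empty => simp
  | basic t ht => exact h t ht
  | compl t htm ih =>
    have h1 := integral_add_compl (hm t htm) hr
    have h2 := h _ huniv
    rw [setIntegral_univ] at h2
    rw [ih, h2, zero_add] at h1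
    exact h1
  | iUnion f hd hfm ih =>
    rw [integral_iUnion (fun i => hm _ (hfm i)) hd hr.integrableOn]
    simp [ih]

lemma setIntegral_eq_zero_of_rect {m₁ mα : MeasurableSpace α} {m₂ mβ : MeasurableSpace β}
    {m₃ mγ : MeasurableSpace γ} (h₁ : m₁ ≤ mα) (h₂ : m₂ ≤ mβ) (h₃ : m₃ ≤ mγ)
    {μ : Measure (α × β × γ)} {r : α × β × γ → ℝ} (hr : Integrable r μ)
    (h : ∀ A B C, MeasurableSet[m₁] A → MeasurableSet[m₂] B → MeasurableSet[m₃] C →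
      ∫ ω in A ×ˢ (B ×ˢ C), r ω ∂μ = 0) (s : Set (α × β × γ))
    (hs : MeasurableSet[m₁.prod (m₂.prod m₃)] s) : ∫ ω in s, r ω ∂μ = 0 := by
  have hle : m₁.prod (m₂.prod m₃) ≤ mα.prod (mβ.prod mγ) :=
    sup_le_sup (MeasurableSpace.comap_mono h₁)
      (MeasurableSpace.comap_mono (sup_le_sup (MeasurableSpace.comap_mono h₂)
        (MeasurableSpace.comap_mono h₃)))
  refine setIntegral_eq_zero_of_isPiSystem (m := m₁.prod (m₂.prod m₃)) hle hr
    (C := Set.image2 (· ×ˢ ·) {A | MeasurableSet[m₁] A}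
      (Set.image2 (· ×ˢ ·) {B | MeasurableSet[m₂] B} {C | MeasurableSet[m₃] C})) ?_ ?_ ?_ ?_ s hs
  · refine (@generateFrom_eq_prod _ _ m₁ (m₂.prod m₃) _ _
      (@MeasurableSpace.generateFrom_measurableSet _ m₁) (@generateFrom_prod _ _ m₂ m₃)
      ?_ ?_).symm
    · exact ⟨fun _ => Set.univ, fun _ => MeasurableSet.univ, Set.iUnion_const _⟩
    · exact ⟨fun _ => Set.univ, fun _ => ⟨Set.univ, MeasurableSet.univ, Set.univ,
        MeasurableSet.univ, Set.univ_prod_univ⟩, Set.iUnion_const _⟩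
  · exact (@MeasurableSpace.isPiSystem_measurableSet _ m₁).prod (@isPiSystem_prod _ _ m₂ m₃)
  · exact ⟨Set.univ, MeasurableSet.univ, Set.univ, ⟨Set.univ, MeasurableSet.univ, Set.univ,
      MeasurableSet.univ, Set.univ_prod_univ⟩, Set.univ_prod_univ⟩
  · rintro _ ⟨A, hA, _, ⟨B, hB, C, hC, rfl⟩, rfl⟩
    exact h A B C hA hB hC

lemma condExp_eq_zero_of_setIntegral_eq_zero {m mα : MeasurableSpace α} (hm : m ≤ mα)
    {μ : Measure α} [IsFiniteMeasure μ] {r : α → ℝ} (hr : Integrable r μ)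
    (h : ∀ s, MeasurableSet[m] s → ∫ ω in s, r ω ∂μ = 0) : μ[r | m] =ᵐ[μ] 0 := by
  refine (ae_eq_condExp_of_forall_setIntegral_eq hm hr (g := 0)
    (fun s _ _ => integrableOn_zero) (fun s hs _ => ?_) aestronglyMeasurable_zero).symm
  simp [h s hs]

lemma aestronglyMeasurable_indicatorConstLp {m mα : MeasurableSpace α} {μ : Measure α}
    [IsFiniteMeasure μ] {A : Set α} (hA : MeasurableSet[m] A) (hA' : MeasurableSet A) :
    AEStronglyMeasurable[m] (indicatorConstLp 2 hA' (measure_ne_top μ A) (1 : ℝ)) μ :=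
  ⟨_, stronglyMeasurable_const.indicator hA, indicatorConstLp_coeFn⟩

lemma tens_indicatorConstLp {mα : MeasurableSpace α} {mβ : MeasurableSpace β}
    {μ : Measure α} {ν : Measure β} [IsProbabilityMeasure μ] [IsProbabilityMeasure ν]
    {A : Set α} {B : Set β} (hA : MeasurableSet A) (hB : MeasurableSet B) :
    tens (indicatorConstLp 2 hA (measure_ne_top μ A) (1 : ℝ))
        (indicatorConstLp 2 hB (measure_ne_top ν B) (1 : ℝ)) =
      indicatorConstLp 2 (hA.prod hB) (measure_ne_top (μ.prod ν) (A ×ˢ B)) (1 : ℝ) := by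
  refine Lp.ext ((coeFn_tens _ _ indicatorConstLp_coeFn indicatorConstLp_coeFn).trans
    (EventuallyEq.trans (Eventually.of_forall fun ω => ?_) indicatorConstLp_coeFn.symm))
  by_cases h1 : ω.1 ∈ A <;> by_cases h2 : ω.2 ∈ B <;> simp [Set.indicator, h1, h2]

lemma aestronglyMeasurable_tens {m₁ mα : MeasurableSpace α} {m₂ mβ : MeasurableSpace β}
    {μ : Measure α} {ν : Measure β} [IsProbabilityMeasure μ] [IsProbabilityMeasure ν]
    {x : Lp ℝ 2 μ} {y : Lp ℝ 2 ν} (hx : AEStronglyMeasurable[m₁] x μ)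
    (hy : AEStronglyMeasurable[m₂] y ν) :
    AEStronglyMeasurable[m₁.prod m₂] (tens x y) (μ.prod ν) := by
  obtain ⟨X, hX, hxX⟩ := hx
  obtain ⟨Y, hY, hyY⟩ := hy
  refine ⟨fun ω => X ω.1 * Y ω.2, ?_, coeFn_tens x y hxX hyY⟩
  exact (hX.comp_measurable (@measurable_fst _ _ m₁ m₂)).mul
    (hY.comp_measurable (@measurable_snd _ _ m₁ m₂))

end SigmaAlgebra

/-! ### Martingale differences are limits of sums of tensors -/

namespace FilteredSystem

variable {Ω : Type*} [MeasurableSpace Ω] {S : FilteredSystem Ω}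

/-- Every square integrable `F₀`-measurable function is the sum of a martingale difference and an
`F₋₁`-measurable function. -/
lemma exists_eq_martingaleDiff_add {x : Lp ℝ 2 S.μ} (hx : AEStronglyMeasurable[S.F₀] x S.μ) :
    ∃ h ∈ S.martingaleDiff, ∃ c : Lp ℝ 2 S.μ, AEStronglyMeasurable[S.filt (-1)] c S.μ ∧
      x = h + c := by
  have hc2 : MemLp (S.μ[x | S.filt (-1)]) 2 S.μ := (Lp.memLp x).condExp (by norm_num)
  have hxi : Integrable x S.μ := (Lp.memLp x).integrable (by norm_num)
  have hcm : AEStronglyMeasurable[S.filt (-1)] hc2.toLp S.μ :=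
    ⟨_, stronglyMeasurable_condExp, hc2.coeFn_toLp⟩
  refine ⟨x - hc2.toLp, ⟨?_, ?_⟩, hc2.toLp, hcm, by abel⟩
  · exact (hx.sub (hcm.mono S.filt_neg_one_le_F₀)).congr (Lp.coeFn_sub _ _).symm
  · have h1 : (x - hc2.toLp : Lp ℝ 2 S.μ) =ᵐ[S.μ] x - S.μ[x | S.filt (-1)] :=
      (Lp.coeFn_sub _ _).trans ((ae_eq_refl _).sub hc2.coeFn_toLp)
    refine (condExp_congr_ae h1).trans ((condExp_sub hxi integrable_condExp _).trans ?_)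
    rw [condExp_of_stronglyMeasurable (S.filt_le (-1)) stronglyMeasurable_condExp
      integrable_condExp, sub_self]

end FilteredSystem

section Structure

variable {Ω₁ Ω₂ Ω₃ : Type*} [MeasurableSpace Ω₁] [MeasurableSpace Ω₂] [MeasurableSpace Ω₃]
  {S₁ : FilteredSystem Ω₁} {S₂ : FilteredSystem Ω₂} {S₃ : FilteredSystem Ω₃}

lemma prodFilt_le (i j k : ℤ) :
    prodFilt S₁ S₂ S₃ i j k ≤ Prod.instMeasurableSpace :=
  sup_le_sup (MeasurableSpace.comap_mono (S₁.filt_le i))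
    (MeasurableSpace.comap_mono (sup_le_sup (MeasurableSpace.comap_mono (S₂.filt_le j))
      (MeasurableSpace.comap_mono (S₃.filt_le k))))

lemma prodFilt_zero :
    prodFilt S₁ S₂ S₃ 0 0 0 = S₁.F₀.prod (S₂.F₀.prod S₃.F₀) :=
  congrArg₂ MeasurableSpace.prod S₁.filt_zero
    (congrArg₂ MeasurableSpace.prod S₂.filt_zero S₃.filt_zero)

variable (S₁ S₂ S₃) in
/-- The tensor of three martingale differences, one for each coordinate. -/
noncomputable def diffTens (q : S₁.martingaleDiff × S₂.martingaleDiff × S₃.martingaleDiff) :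
    Lp ℝ 2 (S₁.μ.prod (S₂.μ.prod S₃.μ)) :=
  tens (q.1 : Lp ℝ 2 S₁.μ) (tens (q.2.1 : Lp ℝ 2 S₂.μ) (q.2.2 : Lp ℝ 2 S₃.μ))

/-- The structure of martingale differences: they lie in the closed span of the tensors of
one-dimensional martingale differences. The component `r` of `F` orthogonal to these tensors is
orthogonal to all rectangles of `F₀⁽¹⁾ ⊗ F₀⁽²⁾ ⊗ F₀⁽³⁾`: splitting each indicator into a
martingale difference and an `F₋₁`-measurable part produces one tensor of martingale differences
and terms orthogonal both to `F` and to the tensors. Hence `r` is orthogonal to `F`, and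
vanishes. -/
theorem mem_closure_span_diffTens {f : Ω₁ × Ω₂ × Ω₃ → ℝ}
    (hf : IsMartingaleDifference (prodFilt S₁ S₂ S₃) (prodMeasure S₁ S₂ S₃) f)
    {F : Lp ℝ 2 (S₁.μ.prod (S₂.μ.prod S₃.μ))} (hF : F =ᵐ[S₁.μ.prod (S₂.μ.prod S₃.μ)] f) :
    F ∈ (Submodule.span ℝ (Set.range (diffTens S₁ S₂ S₃))).topologicalClosure := by
  set D := Submodule.span ℝ (Set.range (diffTens S₁ S₂ S₃)) with hD
  have hDc : CompleteSpace D.topologicalClosure :=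
    (Submodule.isClosed_topologicalClosure D).completeSpace_coe
  obtain ⟨v, hv, r, hr, hvr⟩ := D.topologicalClosure.exists_add_mem_mem_orthogonal F
  have hrD : ∀ w ∈ D, inner ℝ w r = 0 :=
    fun w hw => (Submodule.mem_orthogonal _ _).1 hr w (D.le_topologicalClosure hw)
  -- a vector orthogonal to `F` and to all tensors of martingale differences is orthogonal to `r`
  have hkey : ∀ w : Lp ℝ 2 (S₁.μ.prod (S₂.μ.prod S₃.μ)), inner ℝ F w = 0 →
      (∀ q, inner ℝ (diffTens S₁ S₂ S₃ q) w = 0) → inner ℝ w r = 0 := by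
    intro w hFw hw
    have hwD : w ∈ D.topologicalClosureᗮ := by
      rw [Submodule.orthogonal_closure, Submodule.mem_orthogonal]
      intro u hu
      induction hu using Submodule.span_induction with
      | mem u hu => obtain ⟨q, rfl⟩ := hu; exact hw q
      | zero => simp
      | add u v _ _ hu hv => rw [inner_add_left, hu, hv, add_zero]
      | smul c u _ hu => rw [inner_smul_left, hu, mul_zero]
    have h1 := (Submodule.mem_orthogonal _ _).1 hwD v hv
    rw [hvr, inner_add_left, h1, zero_add] at hFw
    rwa [real_inner_comm]
  have hx : ∀ (x : Lp ℝ 2 S₁.μ) (y : Lp ℝ 2 S₂.μ) (z : Lp ℝ 2 S₃.μ),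
      AEStronglyMeasurable[S₁.F₀] x S₁.μ → AEStronglyMeasurable[S₂.F₀] y S₂.μ →
      AEStronglyMeasurable[S₃.F₀] z S₃.μ → inner ℝ (tens x (tens y z)) r = 0 := by
    intro x y z hx hy hz
    obtain ⟨h, hh, c, hc, rfl⟩ := FilteredSystem.exists_eq_martingaleDiff_add hx
    obtain ⟨h', hh', c', hc', rfl⟩ := FilteredSystem.exists_eq_martingaleDiff_add hy
    obtain ⟨h'', hh'', c'', hc'', rfl⟩ := FilteredSystem.exists_eq_martingaleDiff_add hz
    have hsplit : tens (h + c) (tens (h' + c') (h'' + c'')) = tens h (tens h' h'')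
        + tens c (tens (h' + c') (h'' + c'')) + tens h (tens c' (h'' + c''))
        + tens h (tens h' c'') := by
      simp only [map_add, LinearMap.add_apply]
      abel
    have e1 : inner ℝ (tens h (tens h' h'')) r = 0 :=
      hrD _ (Submodule.subset_span ⟨⟨⟨h, hh⟩, ⟨h', hh'⟩, ⟨h'', hh''⟩⟩, rfl⟩)
    have e2 : inner ℝ (tens c (tens (h' + c') (h'' + c''))) r = 0 := by
      refine hkey _ (inner_eq_zero_of_condExp_eq_zero
        (m := ⨆ (j : ℤ) (k : ℤ), prodFilt S₁ S₂ S₃ (-1) j k)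
        (iSup₂_le fun j k => prodFilt_le (-1) j k)
        ((condExp_congr_ae hF).trans hf.condExp₁) ?_) fun q => ?_
      · rw [← S₂.filt_zero] at hy
        rw [← S₃.filt_zero] at hz
        exact (aestronglyMeasurable_tens hc (aestronglyMeasurable_tens hy hz)).mono
          (le_iSup₂ (f := fun j k => prodFilt S₁ S₂ S₃ (-1) j k) 0 0)
      · rw [diffTens, inner_tens, FilteredSystem.inner_eq_zero_of_mem_martingaleDiff q.1.2 hc,
          zero_mul]
    have e3 : inner ℝ (tens h (tens c' (h'' + c''))) r = 0 := by
      refine hkey _ (inner_eq_zero_of_condExp_eq_zero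
        (m := ⨆ (i : ℤ) (k : ℤ), prodFilt S₁ S₂ S₃ i (-1) k)
        (iSup₂_le fun i k => prodFilt_le i (-1) k)
        ((condExp_congr_ae hF).trans hf.condExp₂) ?_) fun q => ?_
      · have hh0 := hh.1
        rw [← S₁.filt_zero] at hh0
        rw [← S₃.filt_zero] at hz
        exact (aestronglyMeasurable_tens hh0 (aestronglyMeasurable_tens hc' hz)).mono
          (le_iSup₂ (f := fun i k => prodFilt S₁ S₂ S₃ i (-1) k) 0 0)
      · rw [diffTens, inner_tens, inner_tens,
          FilteredSystem.inner_eq_zero_of_mem_martingaleDiff q.2.1.2 hc', zero_mul, mul_zero]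
    have e4 : inner ℝ (tens h (tens h' c'')) r = 0 := by
      refine hkey _ (inner_eq_zero_of_condExp_eq_zero
        (m := ⨆ (i : ℤ) (j : ℤ), prodFilt S₁ S₂ S₃ i j (-1))
        (iSup₂_le fun i j => prodFilt_le i j (-1))
        ((condExp_congr_ae hF).trans hf.condExp₃) ?_) fun q => ?_
      · have hh0 := hh.1
        have hh1 := hh'.1
        rw [← S₁.filt_zero] at hh0
        rw [← S₂.filt_zero] at hh1
        exact (aestronglyMeasurable_tens hh0 (aestronglyMeasurable_tens hh1 hc'')).mono
          (le_iSup₂ (f := fun i j => prodFilt S₁ S₂ S₃ i j (-1)) 0 0)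
      · rw [diffTens, inner_tens, inner_tens,
          FilteredSystem.inner_eq_zero_of_mem_martingaleDiff q.2.2.2 hc'', mul_zero, mul_zero]
    rw [hsplit, inner_add_left, inner_add_left, inner_add_left, e1, e2, e3, e4]
    simp
  have hri : Integrable r (S₁.μ.prod (S₂.μ.prod S₃.μ)) := (Lp.memLp r).integrable (by norm_num)
  have hrect : ∀ A B C, MeasurableSet[S₁.F₀] A → MeasurableSet[S₂.F₀] B →
      MeasurableSet[S₃.F₀] C →
      ∫ ω in A ×ˢ (B ×ˢ C), r ω ∂(S₁.μ.prod (S₂.μ.prod S₃.μ)) = 0 := by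
    intro A B C hA hB hC
    have h0 := hx _ _ _
      (aestronglyMeasurable_indicatorConstLp (μ := S₁.μ) hA (S₁.F₀_le _ hA))
      (aestronglyMeasurable_indicatorConstLp (μ := S₂.μ) hB (S₂.F₀_le _ hB))
      (aestronglyMeasurable_indicatorConstLp (μ := S₃.μ) hC (S₃.F₀_le _ hC))
    rw [tens_indicatorConstLp, tens_indicatorConstLp, L2.inner_indicatorConstLp_one] at h0
    exact h0
  have hset := setIntegral_eq_zero_of_rect S₁.F₀_le S₂.F₀_le S₃.F₀_le hri hrect
  have hle : S₁.F₀.prod (S₂.F₀.prod S₃.F₀) ≤ Prod.instMeasurableSpace :=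
    prodFilt_zero.symm.trans_le (prodFilt_le 0 0 0)
  have hr0 : (S₁.μ.prod (S₂.μ.prod S₃.μ))[r | S₁.F₀.prod (S₂.F₀.prod S₃.F₀)]
      =ᵐ[S₁.μ.prod (S₂.μ.prod S₃.μ)] 0 := condExp_eq_zero_of_setIntegral_eq_zero hle hri hset
  have hfm : Measurable[S₁.F₀.prod (S₂.F₀.prod S₃.F₀)] f :=
    prodFilt_zero (S₁ := S₁) (S₂ := S₂) (S₃ := S₃) ▸ hf.measurable
  have hrF : inner ℝ r F = 0 :=
    inner_eq_zero_of_condExp_eq_zero hle hr0 ⟨f, hfm.stronglyMeasurable, hF⟩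
  have hvr0 : inner ℝ r v = 0 := by
    rw [real_inner_comm]; exact (Submodule.mem_orthogonal _ _).1 hr v hv
  rw [hvr, inner_add_right, hvr0, zero_add, inner_self_eq_zero] at hrF
  rw [hvr, hrF, add_zero]
  exact hv

/-- A point of the closed span of a family lies in the closed span of a countable subfamily. -/
lemma exists_seq_mem_closure_span {κ E : Type*} [NormedAddCommGroup E] [NormedSpace ℝ E]
    [Nonempty κ] {τ : κ → E} {x : E}
    (hx : x ∈ (Submodule.span ℝ (Set.range τ)).topologicalClosure) :
    ∃ q : ℕ → κ, x ∈ (Submodule.span ℝ (Set.range (τ ∘ q))).topologicalClosure := by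
  obtain ⟨u, hu, hux⟩ := mem_closure_iff_seq_limit.1 hx
  choose c hc using fun n => Finsupp.mem_span_range_iff_exists_finsupp.1 (hu n)
  obtain ⟨k₀⟩ := ‹Nonempty κ›
  obtain ⟨q, hq⟩ := ((Set.countable_iUnion fun n => (c n).support.countable_toSet).insert
    k₀).exists_eq_range (Set.insert_nonempty _ _)
  refine ⟨q, mem_closure_iff_seq_limit.2 ⟨u, fun n => ?_, hux⟩⟩
  rw [← hc n, Finsupp.sum]
  refine Submodule.sum_mem _ fun k hk => Submodule.smul_mem _ _ (Submodule.subset_span ?_)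
  have : k ∈ Set.range q := hq ▸ Set.mem_insert_of_mem _ (Set.mem_iUnion.2 ⟨n, hk⟩)
  obtain ⟨m, rfl⟩ := this
  exact ⟨m, rfl⟩

/-- Gram–Schmidt inside the space of martingale differences; the vectors that depend linearly on
their predecessors are replaced by `0`. -/
lemma exists_isOrthogonalDiff_span {Ω : Type*} [MeasurableSpace Ω] (S : FilteredSystem Ω)
    (g : ℕ → S.martingaleDiff) :
    ∃ e : ℕ → Lp ℝ 2 S.μ, IsOrthogonalDiff S e ∧ (∀ a, e a = 0 ∨ ‖e a‖ = 1) ∧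
      ∀ a, (g a : Lp ℝ 2 S.μ) ∈ Submodule.span ℝ (Set.range e) := by
  set g' : ℕ → Lp ℝ 2 S.μ := fun a => g a with hg'
  have hn : ∀ a, InnerProductSpace.gramSchmidtNormed ℝ g' a = 0 ∨
      ‖InnerProductSpace.gramSchmidtNormed ℝ g' a‖ = 1 := fun a =>
    or_iff_not_imp_left.2 InnerProductSpace.gramSchmidtNormed_unit_length'
  have hspan : Submodule.span ℝ (Set.range (InnerProductSpace.gramSchmidtNormed ℝ g')) =
      Submodule.span ℝ (Set.range g') :=
    (InnerProductSpace.span_gramSchmidtNormed_range g').trans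
      (InnerProductSpace.span_gramSchmidt ℝ g')
  refine ⟨InnerProductSpace.gramSchmidtNormed ℝ g', ⟨fun a => ?_, fun a b hab => ?_, fun a => ?_⟩,
    hn, fun a => ?_⟩
  · have hle : Submodule.span ℝ (Set.range g') ≤ S.martingaleDiff :=
      Submodule.span_le.2 (Set.range_subset_iff.2 fun a => (g a).2)
    exact hle (hspan ▸ Submodule.subset_span ⟨a, rfl⟩)
  · simp only [InnerProductSpace.gramSchmidtNormed, inner_smul_left, inner_smul_right,
      InnerProductSpace.gramSchmidt_orthogonal ℝ g' hab, mul_zero]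
  · rcases hn a with h | h
    · simp [h]
    · exact h.le
  · rw [hspan]
    exact Submodule.subset_span ⟨a, rfl⟩

lemma tens_mem_span {α β : Type*} [MeasurableSpace α] [MeasurableSpace β] {μ : Measure α}
    {ν : Measure β} [IsProbabilityMeasure μ] [IsProbabilityMeasure ν] {ι κ : Type*}
    {e : ι → Lp ℝ 2 μ} {e' : κ → Lp ℝ 2 ν} {x : Lp ℝ 2 μ} {y : Lp ℝ 2 ν}
    (hx : x ∈ Submodule.span ℝ (Set.range e)) (hy : y ∈ Submodule.span ℝ (Set.range e')) :
    tens x y ∈ Submodule.span ℝ (Set.range fun p : ι × κ => tens (e p.1) (e' p.2)) := by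
  have h := Submodule.apply_mem_map₂ tens hx hy
  rw [Submodule.map₂_span_span] at h
  refine Submodule.span_mono ?_ h
  rintro _ ⟨_, ⟨a, rfl⟩, _, ⟨b, rfl⟩, rfl⟩
  exact ⟨(a, b), rfl⟩

/-- A martingale difference on the product has an `L²`-convergent expansion into tensors of
one-dimensional, pairwise orthogonal and normalized martingale differences. -/
theorem exists_hasSum_tens {f : Ω₁ × Ω₂ × Ω₃ → ℝ}
    (hf : IsMartingaleDifference (prodFilt S₁ S₂ S₃) (prodMeasure S₁ S₂ S₃) f)
    {F : Lp ℝ 2 (S₁.μ.prod (S₂.μ.prod S₃.μ))} (hF : F =ᵐ[S₁.μ.prod (S₂.μ.prod S₃.μ)] f) :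
    ∃ (e₁ : ℕ → Lp ℝ 2 S₁.μ) (e₂ : ℕ → Lp ℝ 2 S₂.μ) (e₃ : ℕ → Lp ℝ 2 S₃.μ)
      (lam : ℕ × ℕ × ℕ → ℝ), IsOrthogonalDiff S₁ e₁ ∧ IsOrthogonalDiff S₂ e₂ ∧
      IsOrthogonalDiff S₃ e₃ ∧ Summable (fun p => lam p ^ 2) ∧
      (∀ p, lam p ≠ 0 → ‖e₁ p.1‖ = 1 ∧ ‖e₂ p.2.1‖ = 1 ∧ ‖e₃ p.2.2‖ = 1) ∧
      HasSum (fun p => lam p • tens (e₁ p.1) (tens (e₂ p.2.1) (e₃ p.2.2))) F := by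
  obtain ⟨q, hq⟩ := exists_seq_mem_closure_span (mem_closure_span_diffTens hf hF)
  obtain ⟨e₁, h₁, hn₁, hs₁⟩ := exists_isOrthogonalDiff_span S₁ fun n => (q n).1
  obtain ⟨e₂, h₂, hn₂, hs₂⟩ := exists_isOrthogonalDiff_span S₂ fun n => (q n).2.1
  obtain ⟨e₃, h₃, hn₃, hs₃⟩ := exists_isOrthogonalDiff_span S₃ fun n => (q n).2.2
  set w : ℕ × ℕ × ℕ → Lp ℝ 2 (S₁.μ.prod (S₂.μ.prod S₃.μ)) :=
    fun p => tens (e₁ p.1) (tens (e₂ p.2.1) (e₃ p.2.2)) with hw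
  have hle : Submodule.span ℝ (Set.range (diffTens S₁ S₂ S₃ ∘ q)) ≤
      Submodule.span ℝ (Set.range w) := by
    rw [Submodule.span_le]
    rintro _ ⟨n, rfl⟩
    have h := tens_mem_span (hs₁ n) (tens_mem_span (hs₂ n) (hs₃ n))
    exact h
  have horth : ∀ p p', p ≠ p' → inner ℝ (w p) (w p') = 0 :=
    inner_tens_eq_zero h₁.inner_eq_zero h₂.inner_eq_zero h₃.inner_eq_zero
  have hnorm : ∀ p, w p ≠ 0 → ‖e₁ p.1‖ = 1 ∧ ‖e₂ p.2.1‖ = 1 ∧ ‖e₃ p.2.2‖ = 1 := by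
    intro p hp
    refine ⟨(hn₁ _).resolve_left fun h => hp ?_, (hn₂ _).resolve_left fun h => hp ?_,
      (hn₃ _).resolve_left fun h => hp ?_⟩ <;> simp [hw, h]
  have hw1 : ∀ p, w p = 0 ∨ ‖w p‖ = 1 := fun p => or_iff_not_imp_left.2 fun hp => by
    obtain ⟨h1, h2, h3⟩ := hnorm p hp
    simp [hw, norm_tens, h1, h2, h3]
  obtain ⟨hsq, hsum⟩ := hasSum_inner_smul_of_mem_closure horth hw1
    (Submodule.topologicalClosure_mono hle hq)
  refine ⟨e₁, e₂, e₃, fun p => inner ℝ (w p) F, h₁, h₂, h₃, hsq,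
    fun p hp => hnorm p ?_, hsum⟩
  rintro h
  simp [h] at hp

end Structure

/-! ### Series of tensors are martingale differences -/

section Series

/-- If the terms of a series of tensors are orthogonal to all rectangles of `m₁ ⊗ m₂ ⊗ m₃`, then
the conditional expectation of the sum vanishes. -/
lemma condExp_eq_zero_of_hasSum {α β γ : Type*} {m₁ mα : MeasurableSpace α}
    {m₂ mβ : MeasurableSpace β} {m₃ mγ : MeasurableSpace γ} {μ : Measure α} {ν : Measure β}
    {ρ : Measure γ} [IsProbabilityMeasure μ] [IsProbabilityMeasure ν] [IsProbabilityMeasure ρ]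
    {e₁ : ℕ → Lp ℝ 2 μ} {e₂ : ℕ → Lp ℝ 2 ν} {e₃ : ℕ → Lp ℝ 2 ρ} {lam : ℕ × ℕ × ℕ → ℝ}
    (hm₁ : m₁ ≤ mα) (hm₂ : m₂ ≤ mβ) (hm₃ : m₃ ≤ mγ) {m : MeasurableSpace (α × β × γ)}
    (hm : m ≤ m₁.prod (m₂.prod m₃)) {F : Lp ℝ 2 (μ.prod (ν.prod ρ))}
    (hsum : HasSum (fun p => lam p • tens (e₁ p.1) (tens (e₂ p.2.1) (e₃ p.2.2))) F)
    (h0 : ∀ (x : Lp ℝ 2 μ) (y : Lp ℝ 2 ν) (z : Lp ℝ 2 ρ),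
      AEStronglyMeasurable[m₁] x μ → AEStronglyMeasurable[m₂] y ν →
      AEStronglyMeasurable[m₃] z ρ → ∀ a b c,
      inner ℝ x (e₁ a) * (inner ℝ y (e₂ b) * inner ℝ z (e₃ c)) = 0) :
    (μ.prod (ν.prod ρ))[F | m] =ᵐ[μ.prod (ν.prod ρ)] 0 := by
  have hle : m₁.prod (m₂.prod m₃) ≤ mα.prod (mβ.prod mγ) :=
    sup_le_sup (MeasurableSpace.comap_mono hm₁) (MeasurableSpace.comap_mono
      (sup_le_sup (MeasurableSpace.comap_mono hm₂) (MeasurableSpace.comap_mono hm₃)))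
  have hF : Integrable F (μ.prod (ν.prod ρ)) := (Lp.memLp F).integrable (by norm_num)
  refine condExp_eq_zero_of_setIntegral_eq_zero (hm.trans hle) hF fun s hs => ?_
  refine setIntegral_eq_zero_of_rect hm₁ hm₂ hm₃ hF (fun A B C hA hB hC => ?_) s (hm s hs)
  rw [← L2.inner_indicatorConstLp_one (𝕜 := ℝ)
      ((hm₁ _ hA).prod ((hm₂ _ hB).prod (hm₃ _ hC))) (measure_ne_top _ _) F,
    ← tens_indicatorConstLp (hm₁ _ hA) ((hm₂ _ hB).prod (hm₃ _ hC)),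
    ← tens_indicatorConstLp (hm₂ _ hB) (hm₃ _ hC)]
  refine (hsum.mapL (innerSL ℝ _)).tsum_eq.symm.trans
    ((tsum_congr fun p => ?_).trans tsum_zero)
  rw [map_smul, innerSL_apply_apply, inner_tens, inner_tens,
    h0 _ _ _ (aestronglyMeasurable_indicatorConstLp hA _)
      (aestronglyMeasurable_indicatorConstLp hB _) (aestronglyMeasurable_indicatorConstLp hC _),
    smul_zero]

variable {Ω₁ Ω₂ Ω₃ : Type*} [MeasurableSpace Ω₁] [MeasurableSpace Ω₂] [MeasurableSpace Ω₃]
  {S₁ : FilteredSystem Ω₁} {S₂ : FilteredSystem Ω₂} {S₃ : FilteredSystem Ω₃}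
  {e₁ : ℕ → Lp ℝ 2 S₁.μ} {e₂ : ℕ → Lp ℝ 2 S₂.μ} {e₃ : ℕ → Lp ℝ 2 S₃.μ}
  {lam : ℕ × ℕ × ℕ → ℝ}

/-- The sum of a series of tensors of martingale differences has a version that is measurable with
respect to `F_{0,0,0}`, and this version is a martingale difference on the product. -/
theorem exists_isMartingaleDifference_of_hasSum (h₁ : ∀ a, e₁ a ∈ S₁.martingaleDiff)
    (h₂ : ∀ a, e₂ a ∈ S₂.martingaleDiff) (h₃ : ∀ a, e₃ a ∈ S₃.martingaleDiff)
    {F : Lp ℝ 2 (S₁.μ.prod (S₂.μ.prod S₃.μ))}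
    (hsum : HasSum (fun p => lam p • tens (e₁ p.1) (tens (e₂ p.2.1) (e₃ p.2.2))) F) :
    ∃ f, IsMartingaleDifference (prodFilt S₁ S₂ S₃) (prodMeasure S₁ S₂ S₃) f ∧
      F =ᵐ[S₁.μ.prod (S₂.μ.prod S₃.μ)] f := by
  have hF0 : AEStronglyMeasurable[prodFilt S₁ S₂ S₃ 0 0 0] F (S₁.μ.prod (S₂.μ.prod S₃.μ)) := by
    have hfin : ∀ p : ℕ × ℕ × ℕ, tens (e₁ p.1) (tens (e₂ p.2.1) (e₃ p.2.2)) ∈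
        lpMeas ℝ ℝ (prodFilt S₁ S₂ S₃ 0 0 0) 2 (S₁.μ.prod (S₂.μ.prod S₃.μ)) := fun p => by
      rw [mem_lpMeas_iff_aestronglyMeasurable, prodFilt_zero]
      exact aestronglyMeasurable_tens (h₁ _).1 (aestronglyMeasurable_tens (h₂ _).1 (h₃ _).1)
    exact (isClosed_aestronglyMeasurable (prodFilt_le 0 0 0)).mem_of_tendsto hsum
      (Eventually.of_forall fun s => mem_lpMeas_iff_aestronglyMeasurable.1
        (Submodule.sum_mem _ fun p _ => Submodule.smul_mem _ _ (hfin p)))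
  have hFf := hF0.ae_eq_mk
  refine ⟨hF0.mk F, ⟨hF0.stronglyMeasurable_mk.measurable, (Lp.memLp F).ae_eq hFf,
    (condExp_congr_ae hFf.symm).trans ?_, (condExp_congr_ae hFf.symm).trans ?_,
    (condExp_congr_ae hFf.symm).trans ?_⟩, hFf⟩
  · refine condExp_eq_zero_of_hasSum (S₁.filt_le (-1)) le_rfl le_rfl
      (iSup₂_le fun j k => ?_) hsum fun x y z hx _ _ a b c => ?_
    · exact sup_le_sup le_rfl (MeasurableSpace.comap_mono (sup_le_sup
        (MeasurableSpace.comap_mono (S₂.filt_le j)) (MeasurableSpace.comap_mono (S₃.filt_le k))))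
    · rw [real_inner_comm, FilteredSystem.inner_eq_zero_of_mem_martingaleDiff (h₁ a) hx, zero_mul]
  · refine condExp_eq_zero_of_hasSum le_rfl (S₂.filt_le (-1)) le_rfl
      (iSup₂_le fun i k => ?_) hsum fun x y z _ hy _ a b c => ?_
    · exact sup_le_sup (MeasurableSpace.comap_mono (S₁.filt_le i)) (MeasurableSpace.comap_mono
        (sup_le_sup le_rfl (MeasurableSpace.comap_mono (S₃.filt_le k))))
    · rw [real_inner_comm (e₂ b) y,
        FilteredSystem.inner_eq_zero_of_mem_martingaleDiff (h₂ b) hy, zero_mul, mul_zero]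
  · refine condExp_eq_zero_of_hasSum le_rfl le_rfl (S₃.filt_le (-1))
      (iSup₂_le fun i j => ?_) hsum fun x y z _ _ hz a b c => ?_
    · exact sup_le_sup (MeasurableSpace.comap_mono (S₁.filt_le i)) (MeasurableSpace.comap_mono
        (sup_le_sup (MeasurableSpace.comap_mono (S₂.filt_le j)) le_rfl))
    · rw [real_inner_comm (e₃ c) z,
        FilteredSystem.inner_eq_zero_of_mem_martingaleDiff (h₃ c) hz, mul_zero, mul_zero]

end Series

/-! ### The Gaussian shift -/

section Shift

/-- The law of a family of independent standard normal variables indexed by `ℤ × ℕ`. -/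
noncomputable abbrev gaussianField : Measure (ℤ × ℕ → ℝ) :=
  Measure.infinitePi fun _ => gaussianReal 0 1

/-- The σ-algebra generated by the coordinates with index in `J`. -/
abbrev coordAlg (J : Set (ℤ × ℕ)) : MeasurableSpace (ℤ × ℕ → ℝ) :=
  ⨆ p ∈ J, MeasurableSpace.comap (fun ω => ω p) inferInstance

lemma coordAlg_le (J : Set (ℤ × ℕ)) : coordAlg J ≤ MeasurableSpace.pi :=
  iSup₂_le fun p _ => (measurable_pi_apply p).comap_le

lemma measurable_coordAlg {J : Set (ℤ × ℕ)} {p : ℤ × ℕ} (hp : p ∈ J) :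
    Measurable[coordAlg J] fun ω : ℤ × ℕ → ℝ => ω p :=
  measurable_iff_comap_le.2
    (le_iSup₂ (f := fun p (_ : p ∈ J) =>
      MeasurableSpace.comap (fun ω : ℤ × ℕ → ℝ => ω p) inferInstance) p hp)

lemma measurable_to_coordAlg {m : MeasurableSpace (ℤ × ℕ → ℝ)} {J : Set (ℤ × ℕ)}
    {φ : (ℤ × ℕ → ℝ) → ℤ × ℕ → ℝ} (h : ∀ p ∈ J, Measurable[m] fun ω => φ ω p) :
    @Measurable _ _ m (coordAlg J) φ := by
  rw [measurable_iff_comap_le, coordAlg, MeasurableSpace.comap_iSup]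
  refine iSup_le fun p => ?_
  rw [MeasurableSpace.comap_iSup]
  refine iSup_le fun hp => ?_
  rw [MeasurableSpace.comap_comp]
  exact (h p hp).comap_le

lemma indep_coordAlg {J K : Set (ℤ × ℕ)} (h : Disjoint J K) :
    Indep (coordAlg J) (coordAlg K) gaussianField :=
  indep_iSup_of_disjoint (fun p => (measurable_pi_apply p).comap_le)
    (iIndepFun_infinitePi (P := fun _ : ℤ × ℕ => gaussianReal 0 1) (X := fun _ x => x)
      fun _ => measurable_id) h

/-- The shift by `n` in the first index. -/
def shift (n : ℤ) (ω : ℤ × ℕ → ℝ) : ℤ × ℕ → ℝ := fun p => ω (p.1 + n, p.2)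

lemma measurable_shift (n : ℤ) : Measurable (shift n) :=
  measurable_pi_lambda _ fun _ => measurable_pi_apply _

lemma measurePreserving_shift (n : ℤ) :
    MeasurePreserving (shift n) gaussianField gaussianField :=
  ⟨measurable_shift n, Measure.map_infinitePi_infinitePi_of_inj
    (P := fun _ : ℤ × ℕ => gaussianReal 0 1) (f := fun p : ℤ × ℕ => (p.1 + n, p.2))
    fun p q h => by simpa [Prod.ext_iff] using h⟩

/-- The shift by one as an invertible bimeasurable map. -/
def shiftEquiv : (ℤ × ℕ → ℝ) ≃ᵐ (ℤ × ℕ → ℝ) where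
  toFun := shift 1
  invFun := shift (-1)
  left_inv ω := by funext p; simp [shift]
  right_inv ω := by funext p; simp [shift]
  measurable_toFun := measurable_shift 1
  measurable_invFun := measurable_shift (-1)

/-- A cylinder is independent of a distant translate of itself. -/
lemma exists_measureReal_inter_shift_eq_mul {C : Set (ℤ × ℕ → ℝ)}
    (hC : C ∈ measurableCylinders fun _ : ℤ × ℕ => ℝ) :
    ∃ n : ℕ, gaussianField.real (C ∩ shift n ⁻¹' C)
      = gaussianField.real C * gaussianField.real C := by
  obtain ⟨s, S, hS, rfl⟩ := (mem_measurableCylinders _).1 hC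
  have hCm : MeasurableSet[coordAlg s] (cylinder s S) := by
    have h : Measurable[coordAlg s] (s.restrict : (ℤ × ℕ → ℝ) → _) :=
      (@measurable_pi_iff _ _ _ (coordAlg s) _ _).2 fun p =>
        measurable_coordAlg (J := (s : Set (ℤ × ℕ))) p.2
    exact h hS
  -- a translate by more than the diameter of `s` is disjoint from `s`
  obtain ⟨b, hb⟩ : ∃ b : ℕ, ∀ p ∈ s, p.1.natAbs ≤ b :=
    ⟨s.sup fun p => p.1.natAbs, fun p hp => Finset.le_sup (f := fun p => p.1.natAbs) hp⟩
  set n : ℕ := 2 * b + 1 with hn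
  have hdisj : Disjoint (s : Set (ℤ × ℕ)) {q | (q.1 - n, q.2) ∈ s} := by
    rw [Set.disjoint_left]
    intro p hp hq
    have h1 := hb p hp
    have h2 := hb _ hq
    simp only at h2
    omega
  have hsh : @Measurable _ _ (coordAlg {q | (q.1 - n, q.2) ∈ s}) (coordAlg s) (shift n) :=
    measurable_to_coordAlg fun p hp => measurable_coordAlg (by simpa using hp)
  refine ⟨n, ?_⟩
  have h := (Indep_iff _ _ _).1 (indep_coordAlg hdisj) _ _ hCm (hsh hCm)
  rw [measureReal_def, h, ENNReal.toReal_mul, (measurePreserving_shift n).measure_preimage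
    (coordAlg_le _ _ hCm).nullMeasurableSet]
  rfl

/-- An invariant set is approximated by a cylinder, which is independent of a distant translate of
itself. Hence the set is almost independent of itself, and has measure `0` or `1`. -/
lemma ergodic_shift : Ergodic (shift 1) gaussianField := by
  refine ⟨measurePreserving_shift 1, ⟨fun A hA hinv => ?_⟩⟩
  have hinv' : ∀ n : ℕ, shift n ⁻¹' A = A := by
    intro n
    induction n with
    | zero =>
      have : shift ((0 : ℕ) : ℤ) = id := by
        funext ω p
        simp [shift]
      rw [this, Set.preimage_id]
    | succ n ih =>
      have : shift ((n + 1 : ℕ) : ℤ) = shift n ∘ shift 1 := by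
        funext ω p
        simp [shift, add_assoc]
      rw [this, Set.preimage_comp, ih, hinv]
  set x := gaussianField.real A with hx
  have hx1 : x ≤ 1 := measureReal_le_one
  have hx0 : 0 ≤ x := measureReal_nonneg
  have hkey : ∀ ε : ℝ, 0 < ε → |x - x * x| ≤ 4 * ε := by
    intro ε hε
    obtain ⟨C, hC, hCA⟩ := exists_measure_symmDiff_lt_of_generateFrom_isSetRing
      (μ := gaussianField) isSetRing_measurableCylinders
      ⟨{Set.univ}, Set.countable_singleton _, by
        simpa only [Set.singleton_subset_iff] using univ_mem_measurableCylinders _, by simp⟩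
      generateFrom_measurableCylinders.symm hA (ENNReal.ofReal_pos.2 hε)
    have hCm := MeasurableSet.of_mem_measurableCylinders hC
    obtain ⟨n, hn⟩ := exists_measureReal_inter_shift_eq_mul hC
    have hd : gaussianField.real (symmDiff C A) ≤ ε :=
      ENNReal.toReal_le_of_le_ofReal hε.le hCA.le
    have h1 : |gaussianField.real C - x| ≤ ε :=
      (abs_measureReal_sub_le_measureReal_symmDiff hCm.nullMeasurableSet
        hA.nullMeasurableSet).trans hd
    have h2 : |gaussianField.real (C ∩ shift n ⁻¹' C) - x| ≤ 2 * ε := by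
      have hsub : symmDiff (C ∩ shift n ⁻¹' C) A ⊆
          symmDiff C A ∪ shift n ⁻¹' (symmDiff C A) := by
        have h3 : ∀ ω, ω ∈ A ↔ shift n ω ∈ A := fun ω => by
          conv_lhs => rw [← hinv' n]
          rfl
        intro ω
        simp only [Set.mem_symmDiff, Set.mem_inter_iff, Set.mem_union, Set.mem_preimage]
        have := h3 ω
        tauto
      have h4 : gaussianField.real (shift n ⁻¹' (symmDiff C A))
          = gaussianField.real (symmDiff C A) := by
        rw [measureReal_def, (measurePreserving_shift n).measure_preimage
          (hCm.symmDiff hA).nullMeasurableSet]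
        rfl
      refine (abs_measureReal_sub_le_measureReal_symmDiff
        (hCm.inter (measurable_shift n hCm)).nullMeasurableSet hA.nullMeasurableSet).trans ?_
      refine (measureReal_mono hsub).trans ((measureReal_union_le _ _).trans ?_)
      rw [h4]
      linarith
    rw [hn] at h2
    have hc1 : gaussianField.real C ≤ 1 := measureReal_le_one
    have hc0 : 0 ≤ gaussianField.real C := measureReal_nonneg
    rw [abs_le] at h1 h2 ⊢
    constructor <;> nlinarith
  have hxx : x - x * x = 0 := by
    refine abs_eq_zero.1 (le_antisymm (le_of_forall_pos_le_add fun ε hε => ?_) (abs_nonneg _))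
    have := hkey (ε / 4) (by positivity)
    linarith
  rw [eventuallyConst_set']
  rcases mul_eq_zero.1 (show x * (1 - x) = 0 by linarith) with h | h
  · left
    rw [hx, measureReal_eq_zero_iff] at h
    exact ae_eq_empty.2 h
  · right
    have : gaussianField A = 1 := by
      have h5 : gaussianField.real A = 1 := by linarith
      rwa [measureReal_def, ENNReal.toReal_eq_one_iff] at h5
    exact eventuallyEq_univ.2 ((mem_ae_iff_prob_eq_one hA).2 this)

/-- The Gaussian shift, filtered by the past: `F₀` is generated by the coordinates with index
`(i, a)`, `i ≤ 0`. -/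
noncomputable def gaussianShift : FilteredSystem (ℤ × ℕ → ℝ) where
  μ := gaussianField
  isProbabilityMeasure := inferInstance
  T := shiftEquiv
  ergodic := ergodic_shift
  F₀ := coordAlg {p | p.1 ≤ 0}
  F₀_le := coordAlg_le _
  image_mem A hA := by
    have h : @Measurable _ _ (coordAlg {p | p.1 ≤ 0}) (coordAlg {p | p.1 ≤ 0}) (shift (-1)) :=
      measurable_to_coordAlg fun p hp => measurable_coordAlg (by
        simp only [Set.mem_ofPred_eq] at hp ⊢
        omega)
    have h2 := h hA
    rwa [show shift (-1) ⁻¹' A = shiftEquiv '' A from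
      (shiftEquiv.toEquiv.image_eq_preimage_symm A).symm] at h2

lemma gaussianShift_filt_neg_one_le :
    gaussianShift.filt (-1) ≤ coordAlg {p | p.1 < 0} := by
  rw [← measurable_iff_comap_le, FilteredSystem.iter_neg_one]
  exact measurable_to_coordAlg fun p hp => measurable_coordAlg (by
    simp only [Set.mem_ofPred_eq] at hp ⊢
    omega)

lemma memLp_gaussianField_coord (p : ℤ × ℕ) :
    MemLp (fun ω : ℤ × ℕ → ℝ => ω p) 2 gaussianField :=
  (memLp_id_gaussianReal 2).comp_measurePreserving (measurePreserving_eval_infinitePi _ p)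

lemma integral_gaussianField_coord (p : ℤ × ℕ) : ∫ ω, ω p ∂gaussianField = 0 := by
  have h := (measurePreserving_eval_infinitePi (fun _ : ℤ × ℕ => gaussianReal 0 1) p)
  have h2 := integral_map (μ := gaussianField) h.measurable.aemeasurable
    (f := fun x : ℝ => x) aestronglyMeasurable_id
  rw [h.map_eq, integral_id_gaussianReal] at h2
  exact h2.symm

lemma integral_gaussianField_coord_mul (p q : ℤ × ℕ) :
    ∫ ω, ω p * ω q ∂gaussianField = if p = q then 1 else 0 := by
  split_ifs with h
  · subst h
    have h := (measurePreserving_eval_infinitePi (fun _ : ℤ × ℕ => gaussianReal 0 1) p)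
    have h2 := integral_map (μ := gaussianField) h.measurable.aemeasurable
      (f := fun x : ℝ => x * x) (by fun_prop)
    have h1 := variance_eq_sub (memLp_id_gaussianReal (μ := 0) (v := 1) 2)
    rw [variance_id_gaussianReal] at h1
    rw [h.map_eq] at h2
    rw [← h2]
    simpa [pow_two] using h1.symm
  · have h1 := (iIndepFun_infinitePi (P := fun _ : ℤ × ℕ => gaussianReal 0 1)
      (X := fun _ x => x) fun _ => measurable_id).indepFun h
    have h2 := h1.integral_mul_eq_mul_integral (memLp_gaussianField_coord p).1
      (memLp_gaussianField_coord q).1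
    rw [integral_gaussianField_coord, zero_mul] at h2
    exact h2

/-- The coordinates with index `(0, a)`, as elements of `L²`. -/
noncomputable def gaussianCoord (a : ℕ) : Lp ℝ 2 gaussianField :=
  (memLp_gaussianField_coord (0, a)).toLp

lemma orthonormal_gaussianCoord : Orthonormal ℝ gaussianCoord := by
  rw [orthonormal_iff_ite]
  intro a b
  have h := integral_gaussianField_coord_mul (0, a) (0, b)
  simp only [Prod.mk.injEq, true_and] at h
  rw [← h, L2.inner_def]
  refine integral_congr_ae ?_
  filter_upwards [(memLp_gaussianField_coord (0, a)).coeFn_toLp,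
    (memLp_gaussianField_coord (0, b)).coeFn_toLp] with ω ha hb
  simp only [gaussianCoord]
  rw [ha, hb]
  simp [mul_comm]

lemma orthonormal_tens_gaussianCoord :
    Orthonormal ℝ fun p : ℕ × ℕ × ℕ =>
      tens (gaussianCoord p.1) (tens (gaussianCoord p.2.1) (gaussianCoord p.2.2)) := by
  have h := orthonormal_iff_ite.1 orthonormal_gaussianCoord
  rw [orthonormal_iff_ite]
  intro p q
  rw [inner_tens, inner_tens, h, h, h]
  simp only [Prod.ext_iff]
  split_ifs <;> simp_all

lemma gaussianCoord_mem_martingaleDiff (a : ℕ) :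
    gaussianCoord a ∈ gaussianShift.martingaleDiff := by
  have hcoe := (memLp_gaussianField_coord (0, a)).coeFn_toLp
  have hm : ∀ J : Set (ℤ × ℕ), (0, a) ∈ J →
      StronglyMeasurable[coordAlg J] fun ω : ℤ × ℕ → ℝ => ω (0, a) :=
    fun J h => (measurable_coordAlg h).stronglyMeasurable
  refine ⟨⟨_, hm {p | p.1 ≤ 0} (by simp), hcoe⟩, (condExp_congr_ae hcoe).trans ?_⟩
  have hind : Indep (coordAlg {(0, a)}) (gaussianShift.filt (-1)) gaussianField :=
    indep_of_indep_of_le_right (indep_coordAlg (K := {p | p.1 < 0}) (by simp))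
      gaussianShift_filt_neg_one_le
  have h := condExp_indep_eq (coordAlg_le _) (gaussianShift.filt_le (-1)) (hm {(0, a)} rfl) hind
  rw [integral_gaussianField_coord] at h
  exact h

lemma isOrthogonalDiff_gaussianCoord : IsOrthogonalDiff gaussianShift gaussianCoord :=
  ⟨gaussianCoord_mem_martingaleDiff, fun _ _ h => orthonormal_gaussianCoord.2 h,
    fun a => (orthonormal_gaussianCoord.1 a).le⟩

end Shift

end FieldCLT

theorem mainTheorem2 :
    -- For every martingale difference on a product system the limit law has the stated form.
    (∀ (Ω₁ : Type*) (Ω₂ : Type*) (Ω₃ : Type*)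
        [MeasurableSpace Ω₁] [MeasurableSpace Ω₂] [MeasurableSpace Ω₃]
        (S₁ : FieldCLT.FilteredSystem Ω₁) (S₂ : FieldCLT.FilteredSystem Ω₂)
        (S₃ : FieldCLT.FilteredSystem Ω₃) (f : Ω₁ × Ω₂ × Ω₃ → ℝ),
        FieldCLT.IsMartingaleDifference (FieldCLT.prodFilt S₁ S₂ S₃)
          (FieldCLT.prodMeasure S₁ S₂ S₃) f →
        ∃ lam : ℕ × ℕ × ℕ → ℝ, Summable (fun p => lam p ^ 2) ∧
          ∀ (Ω' : Type*) [MeasurableSpace Ω'] (P : Measure Ω') [IsProbabilityMeasure P]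
            (N : Fin 3 → ℕ → Ω' → ℝ), FieldCLT.IsIndepGaussianSequences P N →
            ∃ S : Ω' → ℝ, FieldCLT.IsTripleGaussianSum P N lam S ∧
              TendstoInDistribution
                (FieldCLT.normalizedSum (FieldCLT.prodAction S₁ S₂ S₃) f) FieldCLT.minAtTop S
                (fun _ => FieldCLT.prodMeasure S₁ S₂ S₃) P) ∧
    -- Every square summable family occurs.
    (∀ lam : ℕ × ℕ × ℕ → ℝ, Summable (fun p => lam p ^ 2) →
        ∃ (Ω₁ : Type) (Ω₂ : Type) (Ω₃ : Type)
          (_ : MeasurableSpace Ω₁) (_ : MeasurableSpace Ω₂) (_ : MeasurableSpace Ω₃)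
          (S₁ : FieldCLT.FilteredSystem Ω₁) (S₂ : FieldCLT.FilteredSystem Ω₂)
          (S₃ : FieldCLT.FilteredSystem Ω₃) (f : Ω₁ × Ω₂ × Ω₃ → ℝ),
          FieldCLT.IsMartingaleDifference (FieldCLT.prodFilt S₁ S₂ S₃)
            (FieldCLT.prodMeasure S₁ S₂ S₃) f ∧
          ∀ (Ω' : Type*) [MeasurableSpace Ω'] (P : Measure Ω') [IsProbabilityMeasure P]
            (N : Fin 3 → ℕ → Ω' → ℝ), FieldCLT.IsIndepGaussianSequences P N →
            ∃ S : Ω' → ℝ, FieldCLT.IsTripleGaussianSum P N lam S ∧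
              TendstoInDistribution
                (FieldCLT.normalizedSum (FieldCLT.prodAction S₁ S₂ S₃) f) FieldCLT.minAtTop S
                (fun _ => FieldCLT.prodMeasure S₁ S₂ S₃) P) := by
  refine ⟨fun Ω₁ Ω₂ Ω₃ _ _ _ S₁ S₂ S₃ f hf => ?_, fun lam hlam => ?_⟩
  · have hF := hf.memLp.coeFn_toLp
    obtain ⟨e₁, e₂, e₃, lam, h₁, h₂, h₃, hlam, hlam1, hsum⟩ := FieldCLT.exists_hasSum_tens hf hF
    exact ⟨lam, hlam, fun Ω' _ P _ N hN =>
      FieldCLT.exists_tripleGaussianSum_of_hasSum h₁ h₂ h₃ hlam hlam1 hF hsum hN⟩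
  · have h := FieldCLT.isOrthogonalDiff_gaussianCoord
    have hn := FieldCLT.orthonormal_gaussianCoord.1
    obtain ⟨F, hsum⟩ := FieldCLT.Orthonormal.summable_smul
      FieldCLT.orthonormal_tens_gaussianCoord hlam
    obtain ⟨f, hf, hFf⟩ := FieldCLT.exists_isMartingaleDifference_of_hasSum
      (S₁ := FieldCLT.gaussianShift) (S₂ := FieldCLT.gaussianShift) (S₃ := FieldCLT.gaussianShift)
      h.mem h.mem h.mem hsum
    exact ⟨_, _, _, inferInstance, inferInstance, inferInstance, FieldCLT.gaussianShift,
      FieldCLT.gaussianShift, FieldCLT.gaussianShift, f, hf, fun Ω' _ P _ N hN =>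
      FieldCLT.exists_tripleGaussianSum_of_hasSum h h h hlam
        (fun p _ => ⟨hn _, hn _, hn _⟩) hFf hsum hN⟩
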